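/- Let $s\in(0,1)$, let $n\in\mathbb N$ with $n>2s$, and let $\Omega\subset\mathbb R^n$ be a bounded open set (for instance a bounded Lipschitz domain). Functions are real valued and measurable on $\mathbb R^n$, and are identified when they agree almost everywhere. For $t\in(0,1)$ let $\mathcal H_0^{t}(\Omega)$ be the space of functions $u$ on $\mathbb R^n$ with $u=0$ a.e. in $\mathbb R^n\setminus\Omega$ and $$\|u\|_{\mathcal H_0^t(\Omega)}:=\Bigl(\iint_{\mathbb R^n\times\mathbb R^n}\frac{(u(x)-u(y))^2}{|x-y|^{n+2t}}\,dx\,dy\Bigr)^{1/2}<\infty .$$ Let $c_{n,s}=2^{2s}\pi^{-n/2}\,s\,\Gamma(\tfrac{n+2s}{2})/\Gamma(1-s)$ and $\mathbf k_{s+\mathrm{Log},+}(z)=c_{n,s}|z|^{-n-2s}\max\{0,-\ln|z|\}$ for $z\neq0$, and let $\mathcal H_0^{s+\mathrm{Log}}(\Omega)$ be the space of functions $u\in L^2(\mathbb R^n)$ with $u=0$ a.e. in $\mathbb R^n\setminus\Omega$ and $$\|u\|_{\mathcal H_0^{s+\mathrm{Log}}(\Omega)}:=\Bigl(\iint_{\mathbb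 R^n\times\mathbb R^n}(u(x)-u(y))^2\,\mathbf k_{s+\mathrm{Log},+}(x-y)\,dx\,dy\Bigr)^{1/2}<\infty .$$ (i) For every $\varepsilon\in(0,1-s)$ one has $$\mathcal H_0^{s+\varepsilon}(\Omega)\subset\mathcal H_0^{s+\mathrm{Log}}(\Omega)\subset\mathcal H_0^{s}(\Omega),$$ and both inclusions are continuous with respect to the norms above. (ii) For every $p\in[1,2_s^*]$, where $2_s^*=\frac{2n}{n-2s}$, restriction to $\Omega$ defines a linear embedding $\mathcal H_0^{s+\mathrm{Log}}(\Omega)\hookrightarrow L^p(\Omega)$ that is continuous and compact; in particular, this holds at the critical exponent $p=2_s^*$. -/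

import Mathlib

open MeasureTheory Set
open scoped ENNReal

noncomputable section

namespace FracLog

/-- Euclidean space `ℝⁿ`. -/
abbrev Rn (n : ℕ) : Type := EuclideanSpace ℝ (Fin n)

/-- Real functions on `ℝⁿ` (measurable with respect to Lebesgue measure), modulo equality
almost everywhere. -/
abbrev Fun (n : ℕ) : Type := Rn n →ₘ[(volume : Measure (Rn n))] ℝ

/-- The constant `c_{n,s} = 2^{2s} π^{-n/2} s Γ((n+2s)/2) / Γ(1-s)` for which `(-Δ)^s` has
symbol `|ξ|^{2s}`. -/
def cns (n : ℕ) (s : ℝ) : ℝ :=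
  2 ^ (2 * s) * Real.pi ^ (-(n : ℝ) / 2) * s * Real.Gamma ((n + 2 * s) / 2) / Real.Gamma (1 - s)

/-- The kernel `|z|^{-n-2s}`. -/
def fracKernel (n : ℕ) (s : ℝ) (z : Rn n) : ℝ := ‖z‖ ^ (-(n : ℝ) - 2 * s)

/-- The positive part of the logarithmic kernel, `c_{n,s} |z|^{-n-2s} (-ln |z|)_+`. -/
def logKernel (n : ℕ) (s : ℝ) (z : Rn n) : ℝ :=
  cns n s * ‖z‖ ^ (-(n : ℝ) - 2 * s) * max 0 (-Real.log ‖z‖)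

/-- The energy `∬ (u(x) - u(y))² K(x - y) dx dy ∈ [0, ∞]`. -/
def energy {n : ℕ} (K : Rn n → ℝ) (u : Rn n → ℝ) : ℝ≥0∞ :=
  ∫⁻ p : Rn n × Rn n, ENNReal.ofReal ((u p.1 - u p.2) ^ 2 * K (p.1 - p.2))

lemma measurable_fracKernel (n : ℕ) (s : ℝ) : Measurable (fracKernel n s) := by
  unfold fracKernel
  fun_prop

lemma measurable_logKernel (n : ℕ) (s : ℝ) : Measurable (logKernel n s) := by
  unfold logKernel
  have h : Measurable fun z : Rn n => Real.log ‖z‖ := Real.measurable_log.comp measurable_norm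
  fun_prop

/-- Auxiliary: the measure `K(x - y) dx dy`. -/
def kernelMeasure {n : ℕ} (K : Rn n → ℝ) : Measure (Rn n × Rn n) :=
  (volume : Measure (Rn n × Rn n)).withDensity fun p => ENNReal.ofReal (K (p.1 - p.2))

lemma energy_eq {n : ℕ} {K : Rn n → ℝ} (hK : Measurable K) (u : Rn n → ℝ) :
    energy K u = eLpNorm (fun p : Rn n × Rn n => u p.1 - u p.2) 2 (kernelMeasure K) ^ 2 := by
  have hm : Measurable fun p : Rn n × Rn n => ENNReal.ofReal (K (p.1 - p.2)) :=
    (hK.comp (measurable_fst.sub measurable_snd)).ennreal_ofReal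
  have h2 := eLpNorm_nnreal_pow_eq_lintegral (μ := kernelMeasure K) (p := 2)
    (f := fun p : Rn n × Rn n => u p.1 - u p.2) (by norm_num)
  have h3 : eLpNorm (fun p : Rn n × Rn n => u p.1 - u p.2) 2 (kernelMeasure K) ^ 2
      = ∫⁻ p, ‖u p.1 - u p.2‖ₑ ^ 2 ∂(kernelMeasure K) := by
    simpa only [NNReal.coe_ofNat, ENNReal.coe_ofNat, ENNReal.rpow_ofNat] using h2
  rw [h3, kernelMeasure, lintegral_withDensity_eq_lintegral_mul_non_measurable _ hm
    (Filter.Eventually.of_forall fun _ => ENNReal.ofReal_lt_top)]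
  unfold energy
  refine lintegral_congr fun p => ?_
  simp only [Pi.mul_apply]
  rw [ENNReal.ofReal_mul (sq_nonneg _), mul_comm, ← sq_abs, ENNReal.ofReal_pow (abs_nonneg _),
    Real.enorm_eq_ofReal_abs]

lemma diff_congr {n : ℕ} (K : Rn n → ℝ) {u v : Rn n → ℝ} (h : u =ᵐ[volume] v) :
    (fun p : Rn n × Rn n => u p.1 - u p.2) =ᵐ[kernelMeasure K] fun p => v p.1 - v p.2 := by
  have hac : kernelMeasure K ≪ (volume : Measure (Rn n × Rn n)) := withDensity_absolutelyContinuous _ _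
  refine hac.ae_le ?_
  have h1 : (fun p : Rn n × Rn n => u p.1) =ᵐ[volume] fun p => v p.1 :=
    Measure.quasiMeasurePreserving_fst.ae_eq h
  have h2 : (fun p : Rn n × Rn n => u p.2) =ᵐ[volume] fun p => v p.2 :=
    Measure.quasiMeasurePreserving_snd.ae_eq h
  exact h1.sub h2

lemma aesm_diff {n : ℕ} (K : Rn n → ℝ) (u : Fun n) :
    AEStronglyMeasurable (fun p : Rn n × Rn n => u p.1 - u p.2) (kernelMeasure K) :=
  ((u.stronglyMeasurable.comp_measurable measurable_fst).sub
    (u.stronglyMeasurable.comp_measurable measurable_snd)).aestronglyMeasurable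

lemma eLpNorm_diff_add {n : ℕ} (K : Rn n → ℝ) (u v : Fun n) :
    eLpNorm (fun p : Rn n × Rn n => (u + v : Fun n) p.1 - (u + v : Fun n) p.2) 2 (kernelMeasure K)
      ≤ eLpNorm (fun p : Rn n × Rn n => u p.1 - u p.2) 2 (kernelMeasure K)
        + eLpNorm (fun p : Rn n × Rn n => v p.1 - v p.2) 2 (kernelMeasure K) := by
  rw [eLpNorm_congr_ae (diff_congr K (AEEqFun.coeFn_add u v))]
  have : (fun p : Rn n × Rn n => ((u : Rn n → ℝ) + v) p.1 - ((u : Rn n → ℝ) + v) p.2)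
      = (fun p => u p.1 - u p.2) + fun p => v p.1 - v p.2 := by
    ext p
    simp only [Pi.add_apply]
    ring
  rw [this]
  exact eLpNorm_add_le (aesm_diff K u) (aesm_diff K v) (by norm_num)

lemma eLpNorm_diff_smul {n : ℕ} (K : Rn n → ℝ) (c : ℝ) (u : Fun n) :
    eLpNorm (fun p : Rn n × Rn n => (c • u : Fun n) p.1 - (c • u : Fun n) p.2) 2 (kernelMeasure K)
      = ‖c‖ₑ * eLpNorm (fun p : Rn n × Rn n => u p.1 - u p.2) 2 (kernelMeasure K) := by
  rw [eLpNorm_congr_ae (diff_congr K (AEEqFun.coeFn_smul c u))]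
  have : (fun p : Rn n × Rn n => (c • (u : Rn n → ℝ)) p.1 - (c • (u : Rn n → ℝ)) p.2)
      = c • fun p => u p.1 - u p.2 := by
    ext p
    simp only [Pi.smul_apply, smul_eq_mul]
    ring
  rw [this, eLpNorm_const_smul]

lemma eLpNorm_diff_zero {n : ℕ} (K : Rn n → ℝ) :
    eLpNorm (fun p : Rn n × Rn n => (0 : Fun n) p.1 - (0 : Fun n) p.2) 2 (kernelMeasure K) = 0 := by
  rw [eLpNorm_congr_ae (diff_congr K (AEEqFun.coeFn_zero (μ := volume) (β := ℝ)))]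
  simp

lemma energy_lt_top_iff {n : ℕ} {K : Rn n → ℝ} (hK : Measurable K) (u : Rn n → ℝ) :
    energy K u < ∞ ↔
      eLpNorm (fun p : Rn n × Rn n => u p.1 - u p.2) 2 (kernelMeasure K) < ∞ := by
  rw [energy_eq hK, ENNReal.pow_lt_top_iff]
  simp

/-- The functions `u` on `ℝⁿ` with `∬ (u(x) - u(y))² K(x - y) dx dy < ∞`. -/
def finiteEnergy {n : ℕ} (K : Rn n → ℝ) (hK : Measurable K) : Submodule ℝ (Fun n) where
  carrier := {u | energy K u < ∞}
  add_mem' {u v} hu hv := by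
    simp only [mem_ofPred_eq, energy_lt_top_iff hK] at *
    exact (eLpNorm_diff_add K u v).trans_lt (ENNReal.add_lt_top.2 ⟨hu, hv⟩)
  zero_mem' := by
    simp only [mem_ofPred_eq, energy_lt_top_iff hK, eLpNorm_diff_zero]
    exact ENNReal.zero_lt_top
  smul_mem' c u hu := by
    simp only [mem_ofPred_eq, energy_lt_top_iff hK, eLpNorm_diff_smul] at *
    exact ENNReal.mul_lt_top enorm_lt_top hu

/-- The functions on `ℝⁿ` that vanish a.e. in the complement of `Ω`. -/
def vanishingOff {n : ℕ} (Ω : Set (Rn n)) : Submodule ℝ (Fun n) where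
  carrier := {u | ∀ᵐ x, x ∈ Ωᶜ → u x = 0}
  add_mem' {u v} hu hv := by
    filter_upwards [hu, hv, AEEqFun.coeFn_add u v] with x h1 h2 h3 hx
    simp [h3, h1 hx, h2 hx]
  zero_mem' := by
    filter_upwards [AEEqFun.coeFn_zero (α := Rn n) (μ := volume) (β := ℝ)] with x h1 _
    simp [h1]
  smul_mem' c u hu := by
    filter_upwards [hu, AEEqFun.coeFn_smul c u] with x h1 h3 hx
    simp [h3, h1 hx]

/-- The energy norm `u ↦ (∬ (u(x) - u(y))² K(x - y) dx dy)^{1/2}` as a seminorm on a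
space of functions of finite energy. -/
def energySeminorm {n : ℕ} (K : Rn n → ℝ) (hK : Measurable K) (V : Submodule ℝ (Fun n))
    (hV : V ≤ finiteEnergy K hK) : Seminorm ℝ V :=
  have key : ∀ u : Fun n, Real.sqrt (energy K u).toReal
      = (eLpNorm (fun p : Rn n × Rn n => u p.1 - u p.2) 2 (kernelMeasure K)).toReal := fun u => by
    rw [energy_eq hK, ENNReal.toReal_pow, Real.sqrt_sq ENNReal.toReal_nonneg]
  Seminorm.of (fun u : V => Real.sqrt (energy K (u : Fun n)).toReal)
    (fun u v => by
      have hu := (energy_lt_top_iff hK _).1 (hV u.2)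
      have hv := (energy_lt_top_iff hK _).1 (hV v.2)
      rw [key, key, key, ← ENNReal.toReal_add hu.ne hv.ne]
      exact ENNReal.toReal_mono (ENNReal.add_lt_top.2 ⟨hu, hv⟩).ne (eLpNorm_diff_add K u v))
    (fun c u => by
      rw [key, key, Submodule.coe_smul, eLpNorm_diff_smul, ENNReal.toReal_mul, toReal_enorm])

/-- The fractional space `H₀^s(Ω)`: functions vanishing a.e. outside `Ω` with
`∬ (u(x) - u(y))² |x - y|^{-n-2s} dx dy < ∞`. -/
def H0 (n : ℕ) (s : ℝ) (Ω : Set (Rn n)) : Submodule ℝ (Fun n) :=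
  finiteEnergy (fracKernel n s) (measurable_fracKernel n s) ⊓ vanishingOff Ω

/-- The energy space `H^{s+Log}(ℝⁿ)`: functions `u ∈ L²(ℝⁿ)` with `[u]_{s+Log,+} < ∞`. -/
def HLog (n : ℕ) (s : ℝ) : Submodule ℝ (Fun n) :=
  Lp.LpSubmodule ℝ ℝ 2 volume ⊓ finiteEnergy (logKernel n s) (measurable_logKernel n s)

/-- The space `H₀^{s+Log}(Ω)`: functions in `H^{s+Log}(ℝⁿ)` vanishing a.e. outside `Ω`. -/
def H0Log (n : ℕ) (s : ℝ) (Ω : Set (Rn n)) : Submodule ℝ (Fun n) :=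
  HLog n s ⊓ vanishingOff Ω

/-- `‖u‖ = (∬ (u(x) - u(y))² |x - y|^{-n-2s} dx dy)^{1/2}` on `H₀^s(Ω)`. -/
instance instSeminormedH0 (n : ℕ) (s : ℝ) (Ω : Set (Rn n)) :
    SeminormedAddCommGroup (H0 n s Ω) :=
  (energySeminorm (fracKernel n s) (measurable_fracKernel n s) (H0 n s Ω)
    inf_le_left).toAddGroupSeminorm.toSeminormedAddCommGroup

/-- `‖u‖ = [u]_{s+Log,+} = (∬ (u(x) - u(y))² k_{s+Log,+}(x - y) dx dy)^{1/2}` on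
`H₀^{s+Log}(Ω)`. -/
instance instSeminormedH0Log (n : ℕ) (s : ℝ) (Ω : Set (Rn n)) :
    SeminormedAddCommGroup (H0Log n s Ω) :=
  (energySeminorm (logKernel n s) (measurable_logKernel n s) (H0Log n s Ω)
    (inf_le_left.trans inf_le_right)).toAddGroupSeminorm.toSeminormedAddCommGroup

lemma H0_norm_def {n : ℕ} {s : ℝ} {Ω : Set (Rn n)} (u : H0 n s Ω) :
    ‖u‖ = Real.sqrt (energy (fracKernel n s) (u : Fun n)).toReal := rfl

lemma H0Log_norm_def {n : ℕ} {s : ℝ} {Ω : Set (Rn n)} (u : H0Log n s Ω) :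
    ‖u‖ = Real.sqrt (energy (logKernel n s) (u : Fun n)).toReal := rfl

instance instNormedSpaceH0 (n : ℕ) (s : ℝ) (Ω : Set (Rn n)) : NormedSpace ℝ (H0 n s Ω) where
  norm_smul_le c u := (map_smul_eq_mul (energySeminorm (fracKernel n s)
    (measurable_fracKernel n s) (H0 n s Ω) inf_le_left) c u).le

instance instNormedSpaceH0Log (n : ℕ) (s : ℝ) (Ω : Set (Rn n)) : NormedSpace ℝ (H0Log n s Ω) where
  norm_smul_le c u := (map_smul_eq_mul (energySeminorm (logKernel n s)
    (measurable_logKernel n s) (H0Log n s Ω) (inf_le_left.trans inf_le_right)) c u).le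

end FracLog

end

noncomputable section

namespace FracLog

variable {n : ℕ}

/-! By Tonelli, each energy is the integral of `K h` against the squared `L²` increment `‖u(· + h) -
u‖²`, so everything reduces to comparing kernels and estimating increments. Since `(-ln|z|)₊ ≤
|z|^(-2ε)/(2ε)`, the logarithmic kernel lies below a multiple of the kernel of order `s + ε`. It
vanishes for `|z| ≥ 1`, so it sees only short increments; nevertheless it controls the `L²` norm,
because many short steps along one vector move the bounded set `Ω` off itself
(`lintegral_sq_le_energy`).

The decisive estimate is `energy_frac_le`. For `|z| < δ` the logarithmic kernel exceeds `c_{n,s}(-ln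
δ)` times the fractional one, while the tail `|z| ≥ δ` is integrable and costs only the `L²` norm:
`[u]_s² ≤ (c_{n,s}(-ln δ))⁻¹ [u]_Log² + A_δ ‖u‖₂²`. With Poincaré this gives the second inclusion.
Moreover the first coefficient tends to `0` with `δ`, and this gain yields compactness even at the
critical exponent. The Sobolev inequality (`eLpNorm_sq_le_energy`) bounds `‖u‖_p²` by `[u]_s²`, and
the `L²` remainder is, up to a small multiple of `[u]_s²`, a matter of finitely many ball integrals
(`lintegral_sq_le_means`). An operator controlled in this way is compact
(`isCompactOperator_of_norm_sq_le`). Subcritical and critical exponents are treated alike. -/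

lemma cns_pos {s : ℝ} (hs : s ∈ Ioo (0 : ℝ) 1) : 0 < cns n s := by
  have h1 : 0 < Real.Gamma ((n + 2 * s) / 2) := Real.Gamma_pos_of_pos (by
    have := hs.1
    positivity)
  have h2 : 0 < Real.Gamma (1 - s) := Real.Gamma_pos_of_pos (by linarith [hs.2])
  have := hs.1
  have := Real.pi_pos
  unfold cns
  positivity

lemma fracKernel_nonneg (s : ℝ) (z : Rn n) : 0 ≤ fracKernel n s z :=
  Real.rpow_nonneg (norm_nonneg _) _

/-! ### Energies as iterated integrals -/

/-- The inner integral `∫ (u(x) - u(y))² K(x - y) dy` of the energy. -/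
def energyDensity (K : Rn n → ℝ) (u : Rn n → ℝ) (x : Rn n) : ℝ≥0∞ :=
  ∫⁻ y, ‖u x - u y‖ₑ ^ 2 * ENNReal.ofReal (K (x - y))

lemma energy_integrand (K : Rn n → ℝ) (u : Rn n → ℝ) (x y : Rn n) :
    ENNReal.ofReal ((u x - u y) ^ 2 * K (x - y))
      = ‖u x - u y‖ₑ ^ 2 * ENNReal.ofReal (K (x - y)) := by
  rw [ENNReal.ofReal_mul (sq_nonneg _), ← sq_abs, ENNReal.ofReal_pow (abs_nonneg _),
    Real.enorm_eq_ofReal_abs]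

lemma energy_integrand_measurable {K : Rn n → ℝ} (hK : Measurable K) {u : Rn n → ℝ}
    (hu : Measurable u) : Measurable fun p : Rn n × Rn n =>
      ENNReal.ofReal ((u p.1 - u p.2) ^ 2 * K (p.1 - p.2)) := by
  have h1 : Measurable fun p : Rn n × Rn n => K (p.1 - p.2) := hK.comp (by fun_prop)
  fun_prop

lemma energy_eq_lintegral_density {K : Rn n → ℝ} (hK : Measurable K) {u : Rn n → ℝ}
    (hu : Measurable u) : energy K u = ∫⁻ x, energyDensity K u x := by
  unfold energy energyDensity
  rw [Measure.volume_eq_prod, lintegral_prod _ (energy_integrand_measurable hK hu).aemeasurable]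
  simp_rw [energy_integrand]

/-- The energy in terms of the `L²` modulus of continuity. -/
lemma energy_eq_lintegral_translate {K : Rn n → ℝ} (hK : Measurable K) {u : Rn n → ℝ}
    (hu : Measurable u) :
    energy K u = ∫⁻ h, ENNReal.ofReal (K h) * ∫⁻ y, ‖u (y + h) - u y‖ₑ ^ 2 := by
  have hm := energy_integrand_measurable hK hu
  unfold energy
  rw [Measure.volume_eq_prod, lintegral_prod_symm _ hm.aemeasurable]
  have h1 : ∀ y : Rn n, ∫⁻ x, ENNReal.ofReal ((u x - u y) ^ 2 * K (x - y))
      = ∫⁻ h, ENNReal.ofReal (K h) * ‖u (y + h) - u y‖ₑ ^ 2 := fun y => by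
    rw [← lintegral_add_right_eq_self _ y]
    refine lintegral_congr fun h => ?_
    rw [energy_integrand, add_sub_cancel_right, add_comm h y, mul_comm]
  simp_rw [h1]
  rw [lintegral_lintegral_swap]
  · refine lintegral_congr fun h => ?_
    rw [lintegral_const_mul]
    have : Measurable fun y => u (y + h) := hu.comp (by fun_prop)
    fun_prop
  · have h2 : Measurable fun p : Rn n × Rn n => u (p.1 + p.2) := hu.comp (by fun_prop)
    have h3 : Measurable fun p : Rn n × Rn n => K p.2 := hK.comp (by fun_prop)
    refine Measurable.aemeasurable ?_
    unfold Function.uncurry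
    fun_prop

lemma energy_mono_of_le {K K' : Rn n → ℝ} {C : ℝ} (hC : 0 ≤ C) (h : ∀ z, K z ≤ C * K' z)
    (u : Rn n → ℝ) : energy K u ≤ ENNReal.ofReal C * energy K' u := by
  unfold energy
  rw [← lintegral_const_mul' _ _ ENNReal.ofReal_ne_top]
  refine lintegral_mono fun p => ?_
  simp only
  rw [← ENNReal.ofReal_mul hC]
  refine ENNReal.ofReal_le_ofReal ?_
  nlinarith [mul_le_mul_of_nonneg_left (h (p.1 - p.2)) (sq_nonneg (u p.1 - u p.2))]

lemma sq_eLpNorm_two {α : Type*} [MeasurableSpace α] (μ : Measure α) (f : α → ℝ) :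
    eLpNorm f 2 μ ^ 2 = ∫⁻ x, ‖f x‖ₑ ^ 2 ∂μ := by
  have h2 := eLpNorm_nnreal_pow_eq_lintegral (μ := μ) (p := 2) (f := f) (by norm_num)
  simpa only [NNReal.coe_ofNat, ENNReal.coe_ofNat, ENNReal.rpow_ofNat] using h2

/-! ### Translations in `L²` and the Poincaré inequality -/

lemma eLpNorm_translate {u : Rn n → ℝ} (hu : Measurable u) (p : ℝ≥0∞) (a : Rn n) :
    eLpNorm (fun x => u (x + a)) p volume = eLpNorm u p volume :=
  eLpNorm_comp_measurePreserving (p := p) hu.aestronglyMeasurable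
    (measurePreserving_add_right volume a)

/-- Telescoping: a long increment is a sum of `N` translates of a short one, all of equal norm. This
lets a kernel supported near the origin control large displacements. -/
lemma eLpNorm_translate_nsmul_sub_le {u : Rn n → ℝ} (hu : Measurable u) (h : Rn n) (N : ℕ) :
    eLpNorm (fun x => u (x + N • h) - u x) 2 volume
      ≤ N * eLpNorm (fun x => u (x + h) - u x) 2 volume := by
  have hua : ∀ a : Rn n, Measurable fun x => u (x + a) := fun a => hu.comp (by fun_prop)
  induction N with
  | zero => simp
  | succ N ih =>
    have e : (fun x => u (x + (N + 1) • h) - u x)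
        = (fun x => u (x + N • h + h) - u (x + N • h)) + fun x => u (x + N • h) - u x := by
      ext x
      simp only [Pi.add_apply, add_smul, one_smul, add_assoc]
      ring
    have hd : Measurable fun x => u (x + h) - u x := (hua h).sub hu
    have hd' : Measurable fun x => u (x + N • h + h) - u (x + N • h) := hd.comp (by fun_prop)
    rw [e]
    refine (eLpNorm_add_le hd'.aestronglyMeasurable ((hua _).sub hu).aestronglyMeasurable
      (by norm_num)).trans ?_
    rw [eLpNorm_translate hd 2 (N • h)]
    push_cast
    rw [add_mul, one_mul, add_comm]
    exact add_le_add_left ih _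

lemma lintegral_translate_sub_le {u : Rn n → ℝ} (hu : Measurable u) (h : Rn n) :
    ∫⁻ y, ‖u (y + h) - u y‖ₑ ^ 2 ≤ 4 * ∫⁻ y, ‖u y‖ₑ ^ 2 := by
  have hua : Measurable fun x => u (x + h) := hu.comp (by fun_prop)
  rw [← sq_eLpNorm_two, ← sq_eLpNorm_two]
  have := eLpNorm_sub_le (μ := volume) (p := 2) hua.aestronglyMeasurable hu.aestronglyMeasurable
    (by norm_num)
  rw [eLpNorm_translate hu 2 h, ← two_mul] at this
  calc _ ≤ (2 * eLpNorm u 2 volume) ^ 2 := by gcongr; exact this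
    _ = _ := by ring

/-- A function vanishing off a set `Ω` is dominated by its increments along any vector that moves
`Ω` off itself. -/
lemma eLpNorm_le_of_translate {u : Rn n → ℝ} {Ω : Set (Rn n)}
    (h0 : ∀ᵐ x, x ∈ Ωᶜ → u x = 0) {a : Rn n} (ha : ∀ x ∈ Ω, x + a ∉ Ω) :
    eLpNorm u 2 volume ≤ eLpNorm (fun x => u (x + a) - u x) 2 volume := by
  refine eLpNorm_mono_ae ?_
  have h1 : ∀ᵐ x, x + a ∈ Ωᶜ → u (x + a) = 0 :=
    (measurePreserving_add_right volume a).quasiMeasurePreserving.ae h0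
  filter_upwards [h0, h1] with x hx hxa
  by_cases hxΩ : x ∈ Ω
  · simp [hxa (ha x hxΩ)]
  · simp [hx hxΩ]

/-- Poincaré inequality for kernels bounded below on an annulus. -/
lemma lintegral_sq_le_energy [NeZero n] {K : Rn n → ℝ} (hK : Measurable K) {r m : ℝ} (hr : 0 < r)
    (hm : 0 < m) (hKm : ∀ z : Rn n, r ≤ ‖z‖ → ‖z‖ ≤ 2 * r → m ≤ K z) {Ω : Set (Rn n)}
    (hΩb : Bornology.IsBounded Ω) :
    ∃ C : ℝ, 0 ≤ C ∧ ∀ u : Rn n → ℝ, Measurable u → (∀ᵐ x, x ∈ Ωᶜ → u x = 0) →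
      ∫⁻ x, ‖u x‖ₑ ^ 2 ≤ ENNReal.ofReal C * energy K u := by
  obtain ⟨d, hd⟩ := Metric.isBounded_iff.1 hΩb
  -- `N` steps of length at least `r` exceed the diameter of `Ω`. The maximum keeps `N` positive
  -- even if the bound `d` is negative, as it may be for empty `Ω`.
  obtain ⟨N, hN⟩ := exists_nat_gt (max d 0 / r)
  have hN' : d < N * r := by
    rw [div_lt_iff₀ hr] at hN
    exact (le_max_left _ _).trans_lt hN
  have hNpos : 0 < N := by
    have : (0 : ℝ) < N := lt_of_le_of_lt (by positivity) hN
    exact_mod_cast this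
  set A : Set (Rn n) := {z | r < ‖z‖ ∧ ‖z‖ < 2 * r} with hA
  have hAo : IsOpen A := (isOpen_lt continuous_const continuous_norm).inter
    (isOpen_lt continuous_norm continuous_const)
  -- Here `n ≠ 0` matters: a nonzero vector is rescaled to length `3r/2`.
  have hAne : A.Nonempty := by
    obtain ⟨z, hz⟩ := NormedSpace.exists_lt_norm ℝ (Rn n) 0
    refine ⟨(3 / 2 * r / ‖z‖) • z, ?_⟩
    have : ‖(3 / 2 * r / ‖z‖) • z‖ = 3 / 2 * r := by
      rw [norm_smul, Real.norm_of_nonneg (by positivity)]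
      field_simp
    simp only [hA, mem_ofPred_eq, this]
    constructor <;> linarith
  have hApos : 0 < volume A := hAo.measure_pos _ hAne
  have hAtop : volume A < ∞ := by
    refine (measure_mono (t := Metric.ball 0 (2 * r)) fun z hz => ?_).trans_lt measure_ball_lt_top
    simpa using hz.2
  set v := (volume A).toReal
  have hv : 0 < v := ENNReal.toReal_pos hApos.ne' hAtop.ne
  have hvA : volume A = ENNReal.ofReal v := (ENNReal.ofReal_toReal hAtop.ne).symm
  refine ⟨N ^ 2 / (m * v), by positivity, fun u hu h0 => ?_⟩
  have key : ∀ h ∈ A, ∫⁻ x, ‖u x‖ₑ ^ 2 ≤ N ^ 2 * ∫⁻ y, ‖u (y + h) - u y‖ₑ ^ 2 := fun h hh => by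
    have hmove : ∀ x ∈ Ω, x + N • h ∉ Ω := fun x hx hx' => by
      have h1 := hd hx' hx
      rw [dist_eq_norm, add_sub_cancel_left, ← Nat.cast_smul_eq_nsmul ℝ, norm_smul,
        Real.norm_of_nonneg (by positivity)] at h1
      have : (N : ℝ) * r ≤ N * ‖h‖ := by
        have := hh.1
        gcongr
      linarith
    have h1 := (eLpNorm_le_of_translate h0 hmove).trans (eLpNorm_translate_nsmul_sub_le hu h N)
    rw [← sq_eLpNorm_two, ← sq_eLpNorm_two, ← mul_pow]
    gcongr
  -- Integrating `key` over the annulus, where `K ≥ m`, gives back part of the energy.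
  have hlow : ENNReal.ofReal m * ENNReal.ofReal v * ∫⁻ x, ‖u x‖ₑ ^ 2 ≤ N ^ 2 * energy K u := by
    calc ENNReal.ofReal m * ENNReal.ofReal v * ∫⁻ x, ‖u x‖ₑ ^ 2
        = ∫⁻ _ in A, ENNReal.ofReal m * ∫⁻ x, ‖u x‖ₑ ^ 2 := by
          rw [setLIntegral_const, hvA]; ring
      _ ≤ ∫⁻ h in A, N ^ 2 * (ENNReal.ofReal (K h) * ∫⁻ y, ‖u (y + h) - u y‖ₑ ^ 2) := by
          refine setLIntegral_mono' hAo.measurableSet fun h hh => ?_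
          rw [mul_left_comm]
          exact mul_le_mul' (ENNReal.ofReal_le_ofReal (hKm h hh.1.le hh.2.le)) (key h hh)
      _ ≤ ∫⁻ h, N ^ 2 * (ENNReal.ofReal (K h) * ∫⁻ y, ‖u (y + h) - u y‖ₑ ^ 2) :=
          setLIntegral_le_lintegral _ _
      _ = N ^ 2 * energy K u := by
          rw [lintegral_const_mul' _ _ (by simp), energy_eq_lintegral_translate hK hu]
  have hmv : ENNReal.ofReal (N ^ 2 / (m * v)) * (ENNReal.ofReal m * ENNReal.ofReal v) = N ^ 2 := by
    rw [← ENNReal.ofReal_mul hm.le, ← ENNReal.ofReal_mul (by positivity),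
      div_mul_cancel₀ _ (by positivity), ENNReal.ofReal_pow (by positivity), ENNReal.ofReal_natCast]
  have hc0 : ENNReal.ofReal m * ENNReal.ofReal v ≠ 0 := by
    simp [hm, hv]
  have hct : ENNReal.ofReal m * ENNReal.ofReal v ≠ ∞ := by finiteness
  rw [← ENNReal.mul_le_mul_iff_right hc0 hct]
  refine hlow.trans (le_of_eq ?_)
  rw [← hmv]; ring

/-! ### Comparison of the fractional and logarithmic kernels -/

/-- The tail `|z|^{-n-2s} 1_{|z| ≥ δ}` is integrable. -/
lemma lintegral_fracKernel_tail_lt_top {s δ : ℝ} (hs : 0 < s) (hδ : 0 < δ) :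
    ∫⁻ z in {z : Rn n | δ ≤ ‖z‖}, ENNReal.ofReal (fracKernel n s z) < ∞ := by
  have hint : Integrable (fun z : Rn n => (1 + ‖z‖) ^ (-((n : ℝ) + 2 * s))) :=
    integrable_one_add_norm (by simp [hs])
  have hS : MeasurableSet {z : Rn n | δ ≤ ‖z‖} := measurableSet_le measurable_const measurable_norm
  set D : ℝ := (1 + 1 / δ) ^ ((n : ℝ) + 2 * s)
  have hb : ∀ z ∈ {z : Rn n | δ ≤ ‖z‖}, ENNReal.ofReal (fracKernel n s z)
      ≤ ENNReal.ofReal (D * (1 + ‖z‖) ^ (-((n : ℝ) + 2 * s))) := fun z hz => by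
    refine ENNReal.ofReal_le_ofReal ?_
    have hz' : δ ≤ ‖z‖ := hz
    have hz0 : 0 < ‖z‖ := hδ.trans_le hz'
    have h1 : 1 + ‖z‖ ≤ (1 + 1 / δ) * ‖z‖ := by
      have : 1 ≤ ‖z‖ / δ := (one_le_div hδ).2 hz'
      have e : (1 + 1 / δ) * ‖z‖ = ‖z‖ + ‖z‖ / δ := by ring
      rw [e]; linarith
    have h2 : (1 + ‖z‖) ^ ((n : ℝ) + 2 * s) ≤ D * ‖z‖ ^ ((n : ℝ) + 2 * s) := by
      rw [← Real.mul_rpow (by positivity) hz0.le]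
      exact Real.rpow_le_rpow (by positivity) h1 (by positivity)
    unfold fracKernel
    rw [show -(n : ℝ) - 2 * s = -((n : ℝ) + 2 * s) by ring, Real.rpow_neg hz0.le,
      Real.rpow_neg (by positivity), ← div_eq_mul_inv, inv_eq_one_div,
      div_le_div_iff₀ (by positivity) (by positivity), one_mul]
    exact h2
  refine (setLIntegral_mono' hS hb).trans_lt ((setLIntegral_le_lintegral _ _).trans_lt ?_)
  exact (hint.const_mul D).lintegral_lt_top

/-- The energy of `|z|^{-n-2s}` splits into a short-range part controlled by the logarithmic
energy, with a small constant, and a long-range part controlled by the `L²` norm. -/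
lemma energy_frac_le {s δ : ℝ} (hs : s ∈ Ioo (0 : ℝ) 1) (hδ : δ ∈ Ioo (0 : ℝ) 1) :
    ∃ A : ℝ, 0 ≤ A ∧ ∀ u : Rn n → ℝ, Measurable u →
      energy (fracKernel n s) u ≤ ENNReal.ofReal (1 / (cns n s * -Real.log δ))
        * energy (logKernel n s) u + ENNReal.ofReal A * ∫⁻ x, ‖u x‖ₑ ^ 2 := by
  have hc := cns_pos (n := n) hs
  have hl : 0 < -Real.log δ := neg_pos.2 (Real.log_neg hδ.1 hδ.2)
  have hS : MeasurableSet {z : Rn n | δ ≤ ‖z‖} := measurableSet_le measurable_const measurable_norm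
  set T := ∫⁻ z in {z : Rn n | δ ≤ ‖z‖}, ENNReal.ofReal (fracKernel n s z) with hT
  have hTt : T < ∞ := lintegral_fracKernel_tail_lt_top hs.1 hδ.1
  -- `T` is the mass of the tail; `4` comes from `lintegral_translate_sub_le`.
  refine ⟨T.toReal * 4, by positivity, fun u hu => ?_⟩
  rw [energy_eq_lintegral_translate (measurable_fracKernel n s) hu,
    energy_eq_lintegral_translate (measurable_logKernel n s) hu,
    ← lintegral_const_mul' _ _ ENNReal.ofReal_ne_top,
    ENNReal.ofReal_mul ENNReal.toReal_nonneg, ENNReal.ofReal_toReal hTt.ne,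
    ENNReal.ofReal_ofNat, mul_assoc, hT, ← lintegral_add_compl _ hS, add_comm]
  refine add_le_add ((setLIntegral_mono' hS.compl fun z hz => ?_).trans
    (setLIntegral_le_lintegral _ _)) ?_
  -- Short range: `|z| < δ` gives `-ln δ ≤ -ln|z|`.
  · rw [← mul_assoc, ← ENNReal.ofReal_mul (by positivity)]
    gcongr
    have hz' : ‖z‖ < δ := not_le.1 hz
    -- At the origin both kernels are `0`, by the conventions for `0 ^ x` with `x ≠ 0` and for `log
    -- 0`.
    rcases eq_or_ne z 0 with rfl | hz0
    · have : -(n : ℝ) - 2 * s ≠ 0 := by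
        have := hs.1
        have : (0 : ℝ) ≤ n := by positivity
        linarith
      simp [fracKernel, logKernel, Real.zero_rpow this]
    · have hzp : 0 < ‖z‖ := norm_pos_iff.2 hz0
      have hlog : -Real.log δ ≤ -Real.log ‖z‖ := neg_le_neg (Real.log_le_log hzp hz'.le)
      unfold logKernel
      rw [max_eq_right (hl.le.trans hlog), one_div, ← div_eq_inv_mul, le_div_iff₀ (by positivity)]
      have h1 := fracKernel_nonneg s z
      unfold fracKernel at h1 ⊢
      calc _ = cns n s * ‖z‖ ^ (-(n : ℝ) - 2 * s) * -Real.log δ := by ring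
        _ ≤ _ := by gcongr
  · rw [← lintegral_mul_const _ (measurable_fracKernel n s).ennreal_ofReal]
    refine setLIntegral_mono' hS fun z hz => ?_
    gcongr
    exact lintegral_translate_sub_le hu z

/-- The inequality `ln t ≤ t^(2ε)/(2ε)` at `t = 1/|z|`; the factor `|z|^(-2ε)` is exactly the gap
between the two powers. -/
lemma logKernel_le {s ε : ℝ} (hs : s ∈ Ioo (0 : ℝ) 1) (hε : 0 < ε) (z : Rn n) :
    logKernel n s z ≤ cns n s / (2 * ε) * fracKernel n (s + ε) z := by
  have hc := cns_pos (n := n) hs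
  rcases eq_or_ne z 0 with rfl | hz0
  · simp only [logKernel, norm_zero, Real.log_zero, neg_zero, max_self, mul_zero]
    exact mul_nonneg (by positivity) (fracKernel_nonneg _ _)
  · have hz : 0 < ‖z‖ := norm_pos_iff.2 hz0
    have h1 : max 0 (-Real.log ‖z‖) ≤ ‖z‖ ^ (-(2 * ε)) / (2 * ε) := by
      refine max_le (by positivity) ?_
      have := Real.log_le_rpow_div (x := ‖z‖⁻¹) (ε := 2 * ε) (by positivity) (by positivity)
      rwa [Real.log_inv, Real.inv_rpow hz.le, ← Real.rpow_neg hz.le] at this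
    unfold logKernel fracKernel
    rw [show -(n : ℝ) - 2 * (s + ε) = (-(n : ℝ) - 2 * s) + -(2 * ε) by ring, Real.rpow_add hz]
    calc _ ≤ cns n s * ‖z‖ ^ (-(n : ℝ) - 2 * s) * (‖z‖ ^ (-(2 * ε)) / (2 * ε)) := by gcongr
      _ = _ := by ring

/-- Supplies the hypothesis of the Poincaré inequality with `r = 1/4`: the annulus must stay
strictly inside the unit ball, where the logarithm has not yet been cut off. -/
lemma exists_lower_bound_logKernel {s : ℝ} (hs : s ∈ Ioo (0 : ℝ) 1) :
    ∃ m : ℝ, 0 < m ∧ ∀ z : Rn n, 1 / 4 ≤ ‖z‖ → ‖z‖ ≤ 2 * (1 / 4) → m ≤ logKernel n s z := by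
  have hc := cns_pos (n := n) hs
  have hl : 0 < -Real.log (1 / 2) := neg_pos.2 (Real.log_neg (by norm_num) (by norm_num))
  refine ⟨cns n s * 1 * -Real.log (1 / 2), by positivity, fun z h1 h2 => ?_⟩
  have hz : 0 < ‖z‖ := by linarith
  unfold logKernel
  have hp : 1 ≤ ‖z‖ ^ (-(n : ℝ) - 2 * s) := by
    refine Real.one_le_rpow_of_pos_of_le_one_of_nonpos hz (by linarith) ?_
    have := hs.1
    have : (0 : ℝ) ≤ n := by positivity
    linarith
  have hL : -Real.log (1 / 2) ≤ max 0 (-Real.log ‖z‖) :=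
    le_max_of_le_right (neg_le_neg (Real.log_le_log hz (by linarith)))
  gcongr

/-- Poincaré inequality for the logarithmic energy. -/
lemma lintegral_sq_le_energy_log [NeZero n] {s : ℝ} (hs : s ∈ Ioo (0 : ℝ) 1) {Ω : Set (Rn n)}
    (hΩb : Bornology.IsBounded Ω) :
    ∃ C : ℝ, 0 ≤ C ∧ ∀ u : Rn n → ℝ, Measurable u → (∀ᵐ x, x ∈ Ωᶜ → u x = 0) →
      ∫⁻ x, ‖u x‖ₑ ^ 2 ≤ ENNReal.ofReal C * energy (logKernel n s) u := by
  obtain ⟨m, hm, h⟩ := exists_lower_bound_logKernel (n := n) hs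
  exact lintegral_sq_le_energy (measurable_logKernel n s) (by norm_num) hm h hΩb

/-! ### Pointwise bounds by ball averages -/

/-- The volume of the unit ball. -/
def unitBallVolume (n : ℕ) : ℝ := (volume (Metric.ball (0 : Rn n) 1)).toReal

lemma unitBallVolume_pos : 0 < unitBallVolume n :=
  ENNReal.toReal_pos (Metric.measure_ball_pos _ _ one_pos).ne' measure_ball_lt_top.ne

lemma volume_ball_eq (c : Rn n) {r : ℝ} (hr : 0 < r) :
    volume (Metric.ball c r) = ENNReal.ofReal (r ^ n * unitBallVolume n) := by
  rw [Measure.addHaar_ball_of_pos _ _ hr, ENNReal.ofReal_mul (by positivity), unitBallVolume,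
    ENNReal.ofReal_toReal measure_ball_lt_top.ne]
  simp

lemma ennreal_add_sq_le (a b : ℝ≥0∞) : (a + b) ^ 2 ≤ 4 * a ^ 2 + 4 * b ^ 2 := by
  rcases le_total a b with h | h
  · calc (a + b) ^ 2 ≤ (2 * b) ^ 2 := by rw [two_mul]; gcongr
      _ = 4 * b ^ 2 := by ring
      _ ≤ _ := le_add_self
  · calc (a + b) ^ 2 ≤ (2 * a) ^ 2 := by rw [two_mul]; gcongr
      _ = 4 * a ^ 2 := by ring
      _ ≤ _ := le_self_add

/-- Cauchy–Schwarz against the constant `1`. -/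
lemma sq_lintegral_enorm_le {α : Type*} [MeasurableSpace α] (μ : Measure α) {f : α → ℝ}
    (hf : AEStronglyMeasurable f μ) :
    (∫⁻ x, ‖f x‖ₑ ∂μ) ^ 2 ≤ (∫⁻ x, ‖f x‖ₑ ^ 2 ∂μ) * μ univ := by
  have h := eLpNorm_le_eLpNorm_mul_rpow_measure_univ (μ := μ) (p := 1) (q := 2) (by norm_num) hf
  rw [eLpNorm_one_eq_lintegral_enorm] at h
  have h' : (μ univ ^ (1 / (1 : ℝ≥0∞).toReal - 1 / (2 : ℝ≥0∞).toReal)) ^ 2 = μ univ := by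
    rw [← ENNReal.rpow_natCast, ← ENNReal.rpow_mul]
    norm_num
  calc _ ≤ _ := pow_le_pow_left' h 2
    _ = _ := by rw [mul_pow, h', sq_eLpNorm_two]

/-- Increments over a ball are controlled by the energy density at a point of the ball. -/
lemma setLIntegral_ball_increment_le {s r : ℝ} (hs : 0 < s) (hr : 0 < r) (u : Rn n → ℝ)
    {c x : Rn n} (hx : x ∈ Metric.ball c r) :
    ∫⁻ y in Metric.ball c r, ‖u x - u y‖ₑ ^ 2
      ≤ ENNReal.ofReal ((2 * r) ^ ((n : ℝ) + 2 * s)) * energyDensity (fracKernel n s) u x := by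
  unfold energyDensity
  rw [← lintegral_const_mul' _ _ ENNReal.ofReal_ne_top]
  refine (setLIntegral_mono' Metric.isOpen_ball.measurableSet fun y hy => ?_).trans
    (setLIntegral_le_lintegral _ _)
  rcases eq_or_ne x y with rfl | hxy
  · simp
  have hpos : 0 < ‖x - y‖ := norm_pos_iff.2 (sub_ne_zero.2 hxy)
  have hle : ‖x - y‖ ≤ 2 * r := by
    rw [← dist_eq_norm]
    have h1 := dist_triangle_right x y c
    have h2 : dist x c < r := hx
    have h3 : dist y c < r := hy
    linarith
  have h1 : 1 ≤ (2 * r) ^ ((n : ℝ) + 2 * s) * fracKernel n s (x - y) := by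
    unfold fracKernel
    rw [show -(n : ℝ) - 2 * s = -((n : ℝ) + 2 * s) by ring, Real.rpow_neg hpos.le,
      ← div_eq_mul_inv, one_le_div (by positivity)]
    exact Real.rpow_le_rpow hpos.le hle (by positivity)
  rw [mul_left_comm, ← ENNReal.ofReal_mul (by positivity)]
  calc ‖u x - u y‖ₑ ^ 2 = ‖u x - u y‖ₑ ^ 2 * 1 := (mul_one _).symm
    _ ≤ _ := by
      gcongr
      exact ENNReal.one_le_ofReal.2 h1

/-- Pointwise bound by the mean over a ball and the energy density. -/
lemma enorm_sq_le_mean_add_density {s r : ℝ} (hs : 0 < s) (hr : 0 < r) {u : Rn n → ℝ}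
    (hu : Measurable u) {c x : Rn n} (hui : IntegrableOn u (Metric.ball c r))
    (hx : x ∈ Metric.ball c r) :
    ‖u x‖ₑ ^ 2 ≤ ENNReal.ofReal (4 * 2 ^ ((n : ℝ) + 2 * s) / unitBallVolume n * r ^ (2 * s))
        * energyDensity (fracKernel n s) u x
      + ENNReal.ofReal (4 / (r ^ n * unitBallVolume n) ^ 2)
        * ‖∫ y in Metric.ball c r, u y‖ₑ ^ 2 := by
  have hω := unitBallVolume_pos (n := n)
  set b := r ^ n * unitBallVolume n with hb
  have hbpos : 0 < b := by positivity
  have hB : volume (Metric.ball c r) = ENNReal.ofReal b := volume_ball_eq c hr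
  have hc : IntegrableOn (fun _ => u x) (Metric.ball c r) :=
    integrableOn_const measure_ball_lt_top.ne
  have h1 : b * u x = (∫ y in Metric.ball c r, (u x - u y)) + ∫ y in Metric.ball c r, u y := by
    rw [integral_sub hc hui, setIntegral_const, Measure.real, hB, ENNReal.toReal_ofReal hbpos.le]
    simp
  have h2 : ENNReal.ofReal b * ‖u x‖ₑ ≤ (∫⁻ y in Metric.ball c r, ‖u x - u y‖ₑ)
      + ‖∫ y in Metric.ball c r, u y‖ₑ := by
    calc ENNReal.ofReal b * ‖u x‖ₑ = ‖b * u x‖ₑ := by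
          rw [enorm_mul, Real.enorm_of_nonneg hbpos.le]
      _ ≤ _ := by
          rw [h1]
          exact (enorm_add_le _ _).trans (by gcongr; exact enorm_integral_le_lintegral_enorm _)
  have h3 := sq_lintegral_enorm_le (volume.restrict (Metric.ball c r)) (f := fun y => u x - u y)
    (measurable_const.sub hu).aestronglyMeasurable
  rw [Measure.restrict_apply_univ, hB] at h3
  -- The claim multiplied by `b²`, so that cancellation in `ℝ≥0∞` is left to the very end.
  have h4 : ENNReal.ofReal b ^ 2 * ‖u x‖ₑ ^ 2
      ≤ ENNReal.ofReal b ^ 2 * (ENNReal.ofReal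
          (4 * 2 ^ ((n : ℝ) + 2 * s) / unitBallVolume n * r ^ (2 * s))
        * energyDensity (fracKernel n s) u x
      + ENNReal.ofReal (4 / b ^ 2) * ‖∫ y in Metric.ball c r, u y‖ₑ ^ 2) := by
    rw [← mul_pow]
    refine (pow_le_pow_left' h2 2).trans ((ennreal_add_sq_le _ _).trans ?_)
    rw [mul_add, ← mul_assoc (ENNReal.ofReal b ^ 2), ← mul_assoc (ENNReal.ofReal b ^ 2),
      ← ENNReal.ofReal_pow hbpos.le, ← ENNReal.ofReal_mul (by positivity),
      ← ENNReal.ofReal_mul (by positivity), mul_div_cancel₀ _ (by positivity),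
      ENNReal.ofReal_ofNat]
    refine add_le_add ?_ le_rfl
    -- Cauchy–Schwarz contributes one factor `b`. After removing `b²`, the power `r^(n+2s)` loses
    -- the `r^n` in `b` and becomes `r^(2s)`.
    calc _ ≤ 4 * (ENNReal.ofReal ((2 * r) ^ ((n : ℝ) + 2 * s))
            * energyDensity (fracKernel n s) u x * ENNReal.ofReal b) := by
          gcongr
          exact h3.trans (by gcongr; exact setLIntegral_ball_increment_le hs hr u hx)
      _ = ENNReal.ofReal (4 * (2 * r) ^ ((n : ℝ) + 2 * s) * b)
            * energyDensity (fracKernel n s) u x := by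
          rw [ENNReal.ofReal_mul (p := 4 * (2 * r) ^ ((n : ℝ) + 2 * s)) (by positivity),
            ENNReal.ofReal_mul (p := 4) (by norm_num), ENNReal.ofReal_ofNat]
          ring
      _ = _ := by
          congr 2
          rw [Real.mul_rpow (by norm_num) hr.le, Real.rpow_add hr, Real.rpow_natCast, hb]
          field_simp
  rwa [ENNReal.mul_le_mul_iff_right (by simp [hbpos]) (by finiteness)] at h4

/-- The mean over a ball is controlled by any `L^q` norm. -/
lemma enorm_setIntegral_ball_le {q r : ℝ} (hq : 1 ≤ q) (hr : 0 < r) {u : Rn n → ℝ}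
    (hu : Measurable u) (c : Rn n) :
    ‖∫ y in Metric.ball c r, u y‖ₑ ≤ eLpNorm u (ENNReal.ofReal q) volume
      * ENNReal.ofReal ((r ^ n * unitBallVolume n) ^ (1 - 1 / q)) := by
  have hω := unitBallVolume_pos (n := n)
  have h := eLpNorm_le_eLpNorm_mul_rpow_measure_univ (μ := volume.restrict (Metric.ball c r))
    (f := u) (p := 1) (q := ENNReal.ofReal q) (ENNReal.one_le_ofReal.2 hq) hu.aestronglyMeasurable
  rw [eLpNorm_one_eq_lintegral_enorm, Measure.restrict_apply_univ, volume_ball_eq c hr,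
    ENNReal.ofReal_rpow_of_pos (by positivity), ENNReal.toReal_ofReal (by linarith),
    ENNReal.toReal_one, div_one] at h
  refine (enorm_integral_le_lintegral_enorm _).trans (h.trans ?_)
  exact mul_le_mul' (eLpNorm_mono_measure _ Measure.restrict_le_self) le_rfl

/-! ### The fractional Sobolev inequality -/

lemma two_le_sobolev_exponent {s : ℝ} (hs : 0 < s) (hn : 2 * s < (n : ℝ)) :
    2 ≤ 2 * (n : ℝ) / (n - 2 * s) := by
  rw [le_div_iff₀ (by linarith)]
  linarith

/-- Fractional Sobolev inequality, for functions already known to lie in `L^{2_s^*}`. -/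
lemma eLpNorm_sq_le_energy_of_memLp {s : ℝ} (hs : 0 < s) (hn : 2 * s < (n : ℝ)) :
    ∃ C : ℝ, 0 ≤ C ∧ ∀ u : Rn n → ℝ, Measurable u →
      MemLp u (ENNReal.ofReal (2 * n / (n - 2 * s))) volume →
      eLpNorm u (ENNReal.ofReal (2 * n / (n - 2 * s))) volume ^ 2
        ≤ ENNReal.ofReal C * energy (fracKernel n s) u := by
  have hω := unitBallVolume_pos (n := n)
  set ω := unitBallVolume n
  set a : ℝ := n - 2 * s with ha
  have hapos : 0 < a := by linarith
  have hnpos : (0 : ℝ) < n := by linarith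
  set q : ℝ := 2 * n / a with hq
  have hq2 : 2 ≤ q := two_le_sobolev_exponent hs hn
  have hqa : 2 / q = a / n := by rw [hq]; field_simp
  set C₀ : ℝ := 4 * 2 ^ ((n : ℝ) + 2 * s) / ω with hC₀
  have hC₀pos : 0 < C₀ := by positivity
  set Y : ℝ := 8 * ω ^ (-(2 / q)) with hY
  have hYpos : 0 < Y := by positivity
  refine ⟨2 * C₀ * Y ^ (2 * s / a), by positivity, fun u hu hmem => ?_⟩
  have hqpos : 0 < q := by linarith
  have hq0 : ENNReal.ofReal q ≠ 0 := by simp [hqpos]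
  set N := (eLpNorm u (ENNReal.ofReal q) volume).toReal with hN
  have hNe : eLpNorm u (ENNReal.ofReal q) volume = ENNReal.ofReal N :=
    (ENNReal.ofReal_toReal hmem.2.ne).symm
  rcases eq_or_lt_of_le (show 0 ≤ N from ENNReal.toReal_nonneg) with hN0 | hNpos
  · rw [hNe, ← hN0]; simp
  -- A Hedberg-type argument: the averaging radius is chosen separately at each point, according to
  -- the size of `u x`.
  have point : ∀ x, ‖u x‖ₑ ^ q ≤ ENNReal.ofReal (2 * C₀ * Y ^ (2 * s / a) * N ^ (q - 2))
      * energyDensity (fracKernel n s) u x := fun x => by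
    rcases eq_or_ne (u x) 0 with h0 | h0
    · rw [h0, enorm_zero, ENNReal.zero_rpow_of_pos hqpos]; exact zero_le
    set t := |u x| with ht
    have htpos : 0 < t := abs_pos.2 h0
    have hte : ‖u x‖ₑ = ENNReal.ofReal t := Real.enorm_eq_ofReal_abs _
    -- The mean term is at most `4 N² ω^(-2/q) r^(-a)`, since `2n/q = a`. With `r^a = X` this is
    -- exactly `t²/2`, half of the left side, and can be absorbed.
    set X : ℝ := Y * (N / t) ^ 2 with hX
    have hXpos : 0 < X := by positivity
    set r : ℝ := X ^ (1 / a) with hr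
    have hrpos : 0 < r := by positivity
    have hint : IntegrableOn u (Metric.ball x r) := by
      have : IsFiniteMeasure (volume.restrict (Metric.ball x r)) :=
        ⟨by rw [Measure.restrict_apply_univ]; exact measure_ball_lt_top⟩
      exact (hmem.restrict _).integrable (by simpa using by linarith)
    have h1 := enorm_sq_le_mean_add_density hs hrpos hu hint (Metric.mem_ball_self hrpos)
    have h2 := enorm_setIntegral_ball_le (q := q) (by linarith) hrpos hu x
    have hmean : ENNReal.ofReal (4 / (r ^ n * ω) ^ 2) * ‖∫ y in Metric.ball x r, u y‖ₑ ^ 2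
        ≤ ENNReal.ofReal (t ^ 2 / 2) := by
      calc _ ≤ ENNReal.ofReal (4 / (r ^ n * ω) ^ 2)
            * (ENNReal.ofReal N * ENNReal.ofReal ((r ^ n * ω) ^ (1 - 1 / q))) ^ 2 := by
            rw [← hNe]; gcongr
        _ = ENNReal.ofReal (4 / (r ^ n * ω) ^ 2 * (N * (r ^ n * ω) ^ (1 - 1 / q)) ^ 2) := by
            rw [← ENNReal.ofReal_mul hNpos.le, ← ENNReal.ofReal_pow (by positivity),
              ← ENNReal.ofReal_mul (by positivity)]
        _ = ENNReal.ofReal (t ^ 2 / 2) := by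
            congr 1
            have hb : 0 < r ^ n * ω := by positivity
            have e1 : ((r ^ n * ω) ^ (1 - 1 / q)) ^ 2
                = (r ^ n * ω) ^ 2 * ((r ^ n) ^ (-(2 / q)) * ω ^ (-(2 / q))) := by
              rw [← Real.mul_rpow (by positivity) hω.le,
                ← Real.rpow_natCast ((r ^ n * ω) ^ (1 - 1 / q)) 2,
                ← Real.rpow_natCast (r ^ n * ω) 2, ← Real.rpow_mul hb.le, ← Real.rpow_add hb]
              congr 1
              push_cast
              ring
            have e2 : (r ^ n) ^ (-(2 / q)) = X⁻¹ := by
              rw [← Real.rpow_natCast, ← Real.rpow_mul hrpos.le, hr, ← Real.rpow_mul hXpos.le,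
                hqa, ← Real.rpow_neg_one]
              congr 1
              field_simp
            rw [mul_pow N, e1, e2, hX, hY]
            have hw : 0 < ω ^ (-(2 / q)) := by positivity
            generalize ω ^ (-(2 / q)) = w at hw ⊢
            field_simp
            norm_num
    have h3 : ENNReal.ofReal (t ^ 2) ≤ ENNReal.ofReal (C₀ * r ^ (2 * s))
        * energyDensity (fracKernel n s) u x + ENNReal.ofReal (t ^ 2 / 2) := by
      rw [ENNReal.ofReal_pow htpos.le, ← hte]
      exact h1.trans (by gcongr)
    have h4 : ENNReal.ofReal (t ^ 2 / 2) ≤ ENNReal.ofReal (C₀ * r ^ (2 * s))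
        * energyDensity (fracKernel n s) u x := by
      have e : ENNReal.ofReal (t ^ 2) = ENNReal.ofReal (t ^ 2 / 2) + ENNReal.ofReal (t ^ 2 / 2) := by
        rw [← ENNReal.ofReal_add (by positivity) (by positivity), add_halves]
      rw [e] at h3
      exact (ENNReal.add_le_add_iff_right ENNReal.ofReal_ne_top).1 h3
    -- Because `q - 2 = 4s/a`, the power of `t` inside `r^(2s)` cancels against `t^(q-2)`.
    have hrs : r ^ (2 * s) * t ^ (q - 2) = Y ^ (2 * s / a) * N ^ (q - 2) := by
      have e : q - 2 = 2 * (2 * s / a) := by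
        rw [hq]
        field_simp
        rw [ha]; ring
      rw [hr, ← Real.rpow_mul hXpos.le, show 1 / a * (2 * s) = 2 * s / a by ring, hX,
        Real.mul_rpow hYpos.le (by positivity), ← Real.rpow_natCast,
        ← Real.rpow_mul (by positivity), Nat.cast_ofNat, ← e, mul_assoc,
        ← Real.mul_rpow (by positivity) htpos.le, div_mul_cancel₀ _ htpos.ne']
    rw [hte, ENNReal.ofReal_rpow_of_pos htpos]
    calc ENNReal.ofReal (t ^ q) = ENNReal.ofReal (2 * t ^ (q - 2)) * ENNReal.ofReal (t ^ 2 / 2) := by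
          rw [← ENNReal.ofReal_mul (by positivity)]
          congr 1
          rw [← Real.rpow_natCast t 2, Nat.cast_ofNat,
            show 2 * t ^ (q - 2) * (t ^ (2 : ℝ) / 2) = t ^ (q - 2) * t ^ (2 : ℝ) by ring,
            ← Real.rpow_add htpos, sub_add_cancel]
      _ ≤ ENNReal.ofReal (2 * t ^ (q - 2)) * (ENNReal.ofReal (C₀ * r ^ (2 * s))
        * energyDensity (fracKernel n s) u x) := by gcongr
      _ = _ := by
          rw [← mul_assoc, ← ENNReal.ofReal_mul (by positivity)]
          congr 2
          linear_combination 2 * C₀ * hrs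
  have hint := lintegral_mono point (μ := volume)
  rw [lintegral_const_mul' _ _ ENNReal.ofReal_ne_top,
    ← energy_eq_lintegral_density (measurable_fracKernel n s) hu] at hint
  have hNq : ∫⁻ x, ‖u x‖ₑ ^ q = ENNReal.ofReal (N ^ q) := by
    have h := eLpNorm_eq_lintegral_rpow_enorm_toReal (f := u) (μ := volume) hq0
      ENNReal.ofReal_ne_top
    rw [ENNReal.toReal_ofReal hqpos.le, hNe] at h
    rw [← ENNReal.ofReal_rpow_of_pos hNpos, h, ← ENNReal.rpow_mul, one_div,
      inv_mul_cancel₀ hqpos.ne', ENNReal.rpow_one]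
  rw [hNq] at hint
  -- Dividing by `N^(q-2)` leaves `N²`; this is where a priori membership in `L^q` is needed.
  have hpow : N ^ q = N ^ (q - 2) * N ^ 2 := by
    rw [← Real.rpow_natCast N 2, Nat.cast_ofNat, ← Real.rpow_add hNpos, sub_add_cancel]
  rw [hpow, ENNReal.ofReal_mul (by positivity), mul_comm _ (N ^ (q - 2)),
    ENNReal.ofReal_mul (by positivity), mul_assoc,
    ENNReal.mul_le_mul_iff_right (by simp [Real.rpow_pos_of_pos hNpos]) (by finiteness)] at hint
  rwa [hNe, ← ENNReal.ofReal_pow hNpos.le]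

/-- Fractional Sobolev inequality for functions vanishing off a bounded set. -/
lemma eLpNorm_sq_le_energy {s : ℝ} (hs : 0 < s) (hn : 2 * s < (n : ℝ)) {Ω : Set (Rn n)}
    (hΩb : Bornology.IsBounded Ω) :
    ∃ C : ℝ, 0 ≤ C ∧ ∀ u : Rn n → ℝ, Measurable u → (∀ᵐ x, x ∈ Ωᶜ → u x = 0) →
      eLpNorm u (ENNReal.ofReal (2 * n / (n - 2 * s))) volume ^ 2
        ≤ ENNReal.ofReal C * energy (fracKernel n s) u := by
  obtain ⟨C, hC, h⟩ := eLpNorm_sq_le_energy_of_memLp hs hn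
  refine ⟨C, hC, fun u hu h0 => ?_⟩
  set q := ENNReal.ofReal (2 * n / (n - 2 * s))
  obtain ⟨R, hR⟩ := hΩb.subset_closedBall 0
  -- Truncation at height `M` puts the function in `L^q`, being bounded and supported in a ball. It
  -- is 1-Lipschitz, so it does not increase the energy, and Fatou's lemma then removes it.
  set T : ℕ → ℝ → ℝ := fun M t => max (min t M) (-M) with hT
  have hTm : ∀ M, Measurable (T M) := fun M => by fun_prop
  have hT0 : ∀ M, T M 0 = 0 := fun M => by simp [hT]
  have hTle : ∀ M t, |T M t| ≤ M := fun M t =>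
    abs_le.2 ⟨le_max_right _ _, max_le (min_le_right _ _) (by simp)⟩
  have hTlip : ∀ M x y, |T M x - T M y| ≤ |x - y| := fun M x y =>
    (abs_max_sub_max_le_abs _ _ _).trans ((abs_min_sub_min_le_max _ _ _ _).trans (by simp))
  have hbd : ∀ M, eLpNorm (fun x => T M (u x)) q volume ^ 2
      ≤ ENNReal.ofReal C * energy (fracKernel n s) u := fun M => by
    have hm : Measurable fun x => T M (u x) := (hTm M).comp hu
    have hmem : MemLp (fun x => T M (u x)) q volume := by
      have h1 : (Metric.closedBall (0 : Rn n) R).indicator (fun x => T M (u x))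
          =ᵐ[volume] fun x => T M (u x) := by
        filter_upwards [h0] with x hx
        by_cases hxR : x ∈ Metric.closedBall (0 : Rn n) R
        · simp [hxR]
        · simp [hxR, hx fun h => hxR (hR h), hT0]
      refine MemLp.ae_eq h1 ?_
      rw [memLp_indicator_iff_restrict Metric.isClosed_closedBall.measurableSet]
      have : IsFiniteMeasure (volume.restrict (Metric.closedBall (0 : Rn n) R)) :=
        ⟨by rw [Measure.restrict_apply_univ]; exact measure_closedBall_lt_top⟩
      exact MemLp.of_bound hm.aestronglyMeasurable M (Filter.Eventually.of_forall fun x => hTle M _)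
    refine (h _ hm hmem).trans ?_
    gcongr
    unfold energy
    refine lintegral_mono fun p => ENNReal.ofReal_le_ofReal ?_
    refine mul_le_mul_of_nonneg_right ?_ (fracKernel_nonneg _ _)
    exact sq_le_sq.2 (hTlip M _ _)
  have hlim : ∀ᵐ x, Filter.Tendsto (fun M : ℕ => T M (u x)) Filter.atTop (nhds (u x)) := by
    refine Filter.Eventually.of_forall fun x => ?_
    obtain ⟨M₀, hM₀⟩ := exists_nat_ge |u x|
    refine tendsto_const_nhds.congr' ?_
    filter_upwards [Filter.eventually_ge_atTop M₀] with M hM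
    have : |u x| ≤ M := hM₀.trans (by exact_mod_cast hM)
    rw [hT]
    simp only
    rw [min_eq_left (abs_le.1 this).2, max_eq_left (abs_le.1 this).1]
  have hF := Lp.eLpNorm_lim_le_liminf_eLpNorm (p := q) (μ := volume)
    (f := fun M x => T M (u x)) (fun M => ((hTm M).comp hu).aestronglyMeasurable) u hlim
  set B := ENNReal.ofReal C * energy (fracKernel n s) u
  have hb' : ∀ M, eLpNorm (fun x => T M (u x)) q volume ≤ B ^ (2⁻¹ : ℝ) := fun M => by
    rw [ENNReal.le_rpow_inv_iff (by norm_num)]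
    exact_mod_cast hbd M
  have h1 : eLpNorm u q volume ≤ B ^ (2⁻¹ : ℝ) :=
    hF.trans ((Filter.liminf_le_liminf (Filter.Eventually.of_forall hb')).trans (by simp))
  rw [ENNReal.le_rpow_inv_iff (by norm_num)] at h1
  exact_mod_cast h1

/-! ### Finite-dimensional control and compactness -/

/-- Approximation in `L²` by finitely many means over balls of radius `r`. -/
lemma lintegral_sq_le_means {s r : ℝ} (hs : 0 < s) (hr : 0 < r) {Ω : Set (Rn n)}
    (hΩo : IsOpen Ω) (hΩb : Bornology.IsBounded Ω) :
    ∃ (t : Finset (Rn n)) (A : ℝ), 0 ≤ A ∧ ∀ u : Rn n → ℝ, Measurable u →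
      MemLp u 2 volume → (∀ᵐ x, x ∈ Ωᶜ → u x = 0) →
      ∫⁻ x, ‖u x‖ₑ ^ 2 ≤ ENNReal.ofReal (4 * 2 ^ ((n : ℝ) + 2 * s) / unitBallVolume n * r ^ (2 * s))
          * energy (fracKernel n s) u
        + ENNReal.ofReal A * ∑ c ∈ t, ‖∫ y in Metric.ball c r, u y‖ₑ ^ 2 := by
  have htb : TotallyBounded Ω :=
    (Metric.isCompact_of_isClosed_isBounded isClosed_closure hΩb.closure).totallyBounded.subset
      subset_closure
  obtain ⟨t', ht', hcov⟩ := Metric.totallyBounded_iff.1 htb r hr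
  have hΩt : volume Ω ≠ ∞ := hΩb.measure_lt_top.ne
  -- The centres of a finite cover of `Ω` by `r`-balls. Each point uses the ball that contains it,
  -- and the sum over all centres makes the bound uniform; integrating over `Ω` produces the volume.
  refine ⟨ht'.toFinset, 4 / (r ^ n * unitBallVolume n) ^ 2 * (volume Ω).toReal, by positivity,
    fun u hu hmem h0 => ?_⟩
  have hint : ∀ c, IntegrableOn u (Metric.ball c r) := fun c => by
    have : IsFiniteMeasure (volume.restrict (Metric.ball c r)) :=
      ⟨by rw [Measure.restrict_apply_univ]; exact measure_ball_lt_top⟩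
    exact (hmem.restrict _).integrable (by norm_num)
  set S := ∑ c ∈ ht'.toFinset, ‖∫ y in Metric.ball c r, u y‖ₑ ^ 2
  have hset : ∫⁻ x, ‖u x‖ₑ ^ 2 = ∫⁻ x in Ω, ‖u x‖ₑ ^ 2 := by
    rw [← lintegral_indicator hΩo.measurableSet]
    refine lintegral_congr_ae ?_
    filter_upwards [h0] with x hx
    by_cases hxΩ : x ∈ Ω
    · simp [hxΩ]
    · simp [hxΩ, hx hxΩ]
  have hpt : ∀ x ∈ Ω, ‖u x‖ₑ ^ 2
      ≤ ENNReal.ofReal (4 * 2 ^ ((n : ℝ) + 2 * s) / unitBallVolume n * r ^ (2 * s))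
          * energyDensity (fracKernel n s) u x
        + ENNReal.ofReal (4 / (r ^ n * unitBallVolume n) ^ 2) * S := fun x hx => by
    obtain ⟨c, hc, hxc⟩ := mem_iUnion₂.1 (hcov hx)
    refine (enorm_sq_le_mean_add_density hs hr hu (hint c) hxc).trans ?_
    gcongr
    exact Finset.single_le_sum (f := fun c => ‖∫ y in Metric.ball c r, u y‖ₑ ^ 2)
      (fun _ _ => zero_le) (ht'.mem_toFinset.2 hc)
  rw [hset]
  refine (setLIntegral_mono' hΩo.measurableSet hpt).trans ?_
  rw [lintegral_add_right _ measurable_const, setLIntegral_const,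
    lintegral_const_mul' _ _ ENNReal.ofReal_ne_top,
    energy_eq_lintegral_density (measurable_fracKernel n s) hu,
    ENNReal.ofReal_mul (p := 4 / (r ^ n * unitBallVolume n) ^ 2) (by positivity),
    ENNReal.ofReal_toReal hΩt]
  gcongr ?_ + ?_
  · gcongr
    exact Measure.restrict_le_self
  · exact le_of_eq (by ring)

end FracLog

/-- An operator that is, up to an arbitrarily small multiple of the norm, controlled by operators
into finite-dimensional spaces is compact. -/
lemma isCompactOperator_of_norm_sq_le {E F : Type*} [SeminormedAddCommGroup E] [NormedSpace ℝ E]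
    [NormedAddCommGroup F] [NormedSpace ℝ F] [CompleteSpace F] (T : E →L[ℝ] F)
    (h : ∀ ε > 0, ∃ (κ : Type) (_ : Fintype κ) (Φ : E →L[ℝ] (κ → ℝ)) (C : ℝ),
      ∀ w, ‖T w‖ ^ 2 ≤ ε * ‖w‖ ^ 2 + C * ‖Φ w‖ ^ 2) : IsCompactOperator T := by
  refine (isCompactOperator_iff_isCompact_closure_image_ball (T : E →ₗ[ℝ] F) one_pos).2 ?_
  refine (TotallyBounded.closure ?_).isCompact_of_isClosed isClosed_closure
  refine Metric.totallyBounded_of_finite_discretization fun ε hε => ?_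
  -- Differences of unit-ball elements have squared norm at most `4`, so this term gives `ε²/4`. The
  -- choice of `η` below makes the other at most `ε²/4` since `D ≥ 1`; the total is `ε²/2 < ε²`.
  obtain ⟨κ, _, Φ, C, hC⟩ := h (ε ^ 2 / 16) (by positivity)
  set D := |C| + 1 with hD
  have hDpos : 0 < D := by positivity
  set η := ε / (4 * D) with hη
  have hηpos : 0 < η := by positivity
  have htb : TotallyBounded (Φ '' Metric.ball 0 1) := by
    refine (isCompact_closedBall (0 : κ → ℝ) ‖Φ‖).totallyBounded.subset ?_
    rintro _ ⟨w, hw, rfl⟩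
    rw [mem_closedBall_zero_iff]
    have : ‖w‖ < 1 := by simpa using hw
    exact (Φ.le_opNorm w).trans (mul_le_of_le_one_right (norm_nonneg _) this.le)
  obtain ⟨t, ht, hcov⟩ := Metric.totallyBounded_iff.1 htb η hηpos
  have hex : ∀ x : ((T : E →ₗ[ℝ] F) '' Metric.ball 0 1 : Set F), ∃ w : E, ∃ y : t,
      ‖w‖ < 1 ∧ T w = x ∧ dist (Φ w) y < η := by
    rintro ⟨_, w, hw, rfl⟩
    obtain ⟨y, hy, hwy⟩ := mem_iUnion₂.1 (hcov ⟨w, hw, rfl⟩)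
    exact ⟨w, ⟨y, hy⟩, by simpa using hw, rfl, hwy⟩
  choose w y hw hTw hwy using hex
  have := ht.fintype
  -- `ULift` only matches universes.
  refine ⟨ULift t, inferInstance, fun x => ⟨y x⟩, fun x x' hxx => ?_⟩
  replace hxx : y x = y x' := congrArg ULift.down hxx
  have h1 : ‖Φ (w x - w x')‖ < 2 * η := by
    rw [map_sub, ← dist_eq_norm]
    have e1 := hwy x
    have e2 := hwy x'
    rw [← hxx] at e2
    linarith [dist_triangle_right (Φ (w x)) (Φ (w x')) (y x : κ → ℝ)]
  have h2 : ‖w x - w x'‖ ≤ 2 := by linarith [norm_sub_le (w x) (w x'), hw x, hw x']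
  have h3 := hC (w x - w x')
  rw [dist_eq_norm, ← hTw x, ← hTw x', ← map_sub]
  refine lt_of_pow_lt_pow_left₀ 2 hε.le ?_
  have h4 : ‖w x - w x'‖ ^ 2 ≤ 4 := by nlinarith [norm_nonneg (w x - w x')]
  have h5 : ‖Φ (w x - w x')‖ ^ 2 ≤ (2 * η) ^ 2 := by gcongr
  have h6 : C * ‖Φ (w x - w x')‖ ^ 2 ≤ D * (2 * η) ^ 2 := by
    have : C ≤ D := (le_abs_self C).trans (by linarith)
    gcongr
  have h7 : D * (2 * η) ^ 2 = ε ^ 2 / 4 / D := by rw [hη]; field_simp; norm_num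
  have h8 : ε ^ 2 / 4 / D ≤ ε ^ 2 / 4 := div_le_self (by positivity) (by rw [hD]; simp)
  nlinarith [sq_pos_of_pos hε]

namespace FracLog

variable {n : ℕ}

/-! ### The inclusions and the compact embedding -/

/-- Passes from `[0, ∞]`-valued energies to norms; `hfin` is essential because `toReal` sends `∞` to
`0`. -/
lemma sqrt_energy_le {K K' : Rn n → ℝ} {u : Rn n → ℝ} {C : ℝ} (hC : 0 ≤ C)
    (hfin : energy K' u < ∞) (h : energy K u ≤ ENNReal.ofReal C * energy K' u) :
    Real.sqrt (energy K u).toReal ≤ Real.sqrt C * Real.sqrt (energy K' u).toReal := by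
  rw [← Real.sqrt_mul hC]
  refine Real.sqrt_le_sqrt ?_
  have := ENNReal.toReal_mono (ENNReal.mul_lt_top ENNReal.ofReal_lt_top hfin).ne h
  rwa [ENNReal.toReal_mul, ENNReal.toReal_ofReal hC] at this

section Log

variable {s : ℝ} {Ω : Set (Rn n)}

lemma H0Log_energy_lt_top (u : H0Log n s Ω) : energy (logKernel n s) (u : Fun n) < ∞ := u.2.1.2

lemma H0Log_ae_eq_zero (u : H0Log n s Ω) : ∀ᵐ x, x ∈ Ωᶜ → (u : Fun n) x = 0 := u.2.2

lemma H0Log_memLp (u : H0Log n s Ω) : MemLp (u : Fun n) 2 volume :=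
  Lp.mem_Lp_iff_memLp.1 u.2.1.1

lemma Fun_measurable (u : Fun n) : Measurable u := u.stronglyMeasurable.measurable

lemma H0Log_energy_eq (u : H0Log n s Ω) :
    energy (logKernel n s) (u : Fun n) = ENNReal.ofReal (‖u‖ ^ 2) := by
  rw [H0Log_norm_def, Real.sq_sqrt ENNReal.toReal_nonneg,
    ENNReal.ofReal_toReal (H0Log_energy_lt_top u).ne]

/-- Splitting at the fixed radius `1/2`, with the `L²` remainder absorbed by Poincaré. -/
lemma energy_frac_le_energy_log [NeZero n] (hs : s ∈ Ioo (0 : ℝ) 1)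
    (hΩb : Bornology.IsBounded Ω) :
    ∃ C : ℝ, 0 ≤ C ∧ ∀ u : Rn n → ℝ, Measurable u → (∀ᵐ x, x ∈ Ωᶜ → u x = 0) →
      energy (fracKernel n s) u ≤ ENNReal.ofReal C * energy (logKernel n s) u := by
  obtain ⟨P, hP, hPoincare⟩ := lintegral_sq_le_energy_log hs hΩb
  obtain ⟨A, hA, hsplit⟩ := energy_frac_le (n := n) hs (δ := 1 / 2) ⟨by norm_num, by norm_num⟩
  have hc := cns_pos (n := n) hs
  have hl : 0 < -Real.log (1 / 2) := neg_pos.2 (Real.log_neg (by norm_num) (by norm_num))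
  refine ⟨1 / (cns n s * -Real.log (1 / 2)) + A * P, by positivity, fun u hu h0 => ?_⟩
  refine (hsplit u hu).trans ?_
  rw [ENNReal.ofReal_add (by positivity) (by positivity), ENNReal.ofReal_mul hA, add_mul, mul_assoc]
  gcongr
  exact hPoincare u hu h0

/-- `H₀^{s+ε}(Ω) ⊂ H₀^{s+Log}(Ω)`, continuously. -/
lemma continuous_inclusion_H0_H0Log [NeZero n] (hs : s ∈ Ioo (0 : ℝ) 1)
    (hΩb : Bornology.IsBounded Ω) {ε : ℝ} (hε : 0 < ε) :
    ∃ h : H0 n (s + ε) Ω ≤ H0Log n s Ω, Continuous (Submodule.inclusion h) := by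
  have hc := cns_pos (n := n) hs
  have hC : 0 ≤ cns n s / (2 * ε) := by positivity
  have hle : ∀ u : Fun n, energy (logKernel n s) u
      ≤ ENNReal.ofReal (cns n s / (2 * ε)) * energy (fracKernel n (s + ε)) u := fun u =>
    energy_mono_of_le hC (logKernel_le hs hε) u
  obtain ⟨P, hP, hPoincare⟩ := lintegral_sq_le_energy_log hs hΩb
  have hsub : H0 n (s + ε) Ω ≤ H0Log n s Ω := fun u hu => by
    have hE : energy (fracKernel n (s + ε)) u < ∞ := hu.1
    have hlog : energy (logKernel n s) u < ∞ := (hle u).trans_lt (ENNReal.mul_lt_top ENNReal.ofReal_lt_top hE)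
    -- Square integrability is not part of `H0`; it comes from the Poincaré inequality for the
    -- logarithmic energy.
    refine ⟨⟨Lp.mem_Lp_iff_eLpNorm_lt_top.2 ?_, hlog⟩, hu.2⟩
    have h2 := hPoincare u (Fun_measurable u) hu.2
    rw [← sq_eLpNorm_two] at h2
    have : eLpNorm u 2 volume ^ 2 < ∞ := h2.trans_lt (ENNReal.mul_lt_top ENNReal.ofReal_lt_top hlog)
    simpa [ENNReal.pow_lt_top_iff] using this
  refine ⟨hsub, AddMonoidHomClass.continuous_of_bound (Submodule.inclusion hsub)
    (Real.sqrt (cns n s / (2 * ε))) fun u => ?_⟩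
  rw [H0Log_norm_def, H0_norm_def]
  exact sqrt_energy_le hC u.2.1 (hle u)

/-- `H₀^{s+Log}(Ω) ⊂ H₀^s(Ω)`, continuously. -/
lemma continuous_inclusion_H0Log_H0 [NeZero n] (hs : s ∈ Ioo (0 : ℝ) 1)
    (hΩb : Bornology.IsBounded Ω) :
    ∃ h : H0Log n s Ω ≤ H0 n s Ω, Continuous (Submodule.inclusion h) := by
  obtain ⟨C, hC, hle⟩ := energy_frac_le_energy_log hs hΩb
  have hsub : H0Log n s Ω ≤ H0 n s Ω := fun u hu => by
    have hE : energy (logKernel n s) u < ∞ := hu.1.2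
    exact ⟨(hle u (Fun_measurable u) hu.2).trans_lt
      (ENNReal.mul_lt_top ENNReal.ofReal_lt_top hE), hu.2⟩
  refine ⟨hsub, AddMonoidHomClass.continuous_of_bound (Submodule.inclusion hsub)
    (Real.sqrt C) fun u => ?_⟩
  rw [H0Log_norm_def, H0_norm_def]
  exact sqrt_energy_le hC (H0Log_energy_lt_top u)
    (hle _ (Fun_measurable _) (H0Log_ae_eq_zero u))

/-- Fractional Sobolev inequality for all exponents up to the critical one. -/
lemma eLpNorm_restrict_sq_le_energy (hs : 0 < s) (hn : 2 * s < (n : ℝ))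
    (hΩb : Bornology.IsBounded Ω) {p : ℝ≥0∞} (hp1 : 1 ≤ p)
    (hp : p ≤ ENNReal.ofReal (2 * n / (n - 2 * s))) :
    ∃ C : ℝ, 0 ≤ C ∧ ∀ u : Rn n → ℝ, Measurable u → (∀ᵐ x, x ∈ Ωᶜ → u x = 0) →
      eLpNorm u p (volume.restrict Ω) ^ 2 ≤ ENNReal.ofReal C * energy (fracKernel n s) u := by
  obtain ⟨C, hC, h⟩ := eLpNorm_sq_le_energy hs hn hΩb
  set q := ENNReal.ofReal (2 * n / (n - 2 * s)) with hq
  have hptop : p ≠ ∞ := (hp.trans_lt ENNReal.ofReal_lt_top).ne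
  -- The Hölder factor for passing from the critical exponent to `p` on `Ω`.
  set D := volume Ω ^ (1 / p.toReal - 1 / q.toReal) with hD
  have hexp : 0 ≤ 1 / p.toReal - 1 / q.toReal := by
    have h1 : 1 ≤ p.toReal := by
      simpa using ENNReal.toReal_mono hptop hp1
    have h2 : p.toReal ≤ q.toReal := ENNReal.toReal_mono ENNReal.ofReal_ne_top hp
    exact sub_nonneg.2 (one_div_le_one_div_of_le (by linarith) h2)
  have hDtop : D ≠ ∞ := ENNReal.rpow_ne_top_of_nonneg hexp hΩb.measure_lt_top.ne
  refine ⟨D.toReal ^ 2 * C, by positivity, fun u hu h0 => ?_⟩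
  have h1 := eLpNorm_le_eLpNorm_mul_rpow_measure_univ (μ := volume.restrict Ω) hp
    hu.aestronglyMeasurable
  rw [Measure.restrict_apply_univ] at h1
  have h2 : eLpNorm u p (volume.restrict Ω) ≤ eLpNorm u q volume * D :=
    h1.trans (mul_le_mul' (eLpNorm_mono_measure _ Measure.restrict_le_self) le_rfl)
  calc _ ≤ (eLpNorm u q volume * D) ^ 2 := pow_le_pow_left' h2 2
    _ = D ^ 2 * eLpNorm u q volume ^ 2 := by ring
    _ ≤ D ^ 2 * (ENNReal.ofReal C * energy (fracKernel n s) u) := by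
      gcongr
      exact h u hu h0
    _ = _ := by
      rw [ENNReal.ofReal_mul (by positivity), ENNReal.ofReal_pow ENNReal.toReal_nonneg,
        ENNReal.ofReal_toReal hDtop, mul_assoc]

/-- Integration over a ball, as a continuous functional on `H₀^{s+Log}(Ω)`. -/
lemma exists_ballIntegral [NeZero n] (hs : s ∈ Ioo (0 : ℝ) 1) (hΩb : Bornology.IsBounded Ω)
    (c : Rn n) {r : ℝ} (hr : 0 < r) :
    ∃ φ : H0Log n s Ω →L[ℝ] ℝ, ∀ u, φ u = ∫ y in Metric.ball c r, (u : Fun n) y := by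
  obtain ⟨P, hP, hPoincare⟩ := lintegral_sq_le_energy_log hs hΩb
  have hint : ∀ u : H0Log n s Ω, IntegrableOn (u : Fun n) (Metric.ball c r) := fun u => by
    have : IsFiniteMeasure (volume.restrict (Metric.ball c r)) :=
      ⟨by rw [Measure.restrict_apply_univ]; exact measure_ball_lt_top⟩
    exact ((H0Log_memLp u).restrict _).integrable (by norm_num)
  let φ : H0Log n s Ω →ₗ[ℝ] ℝ :=
    { toFun := fun u => ∫ y in Metric.ball c r, (u : Fun n) y
      map_add' := fun u v => by
        rw [← integral_add (hint u) (hint v)]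
        exact integral_congr_ae (ae_restrict_of_ae (AEEqFun.coeFn_add (u : Fun n) (v : Fun n)))
      map_smul' := fun a u => by
        rw [RingHom.id_apply, ← integral_smul]
        exact integral_congr_ae (ae_restrict_of_ae (AEEqFun.coeFn_smul a (u : Fun n))) }
  set D := (r ^ n * unitBallVolume n) ^ (1 - 1 / (2 : ℝ))
  have hω := unitBallVolume_pos (n := n)
  refine ⟨φ.mkContinuous (Real.sqrt P * D) fun u => ?_, fun u => rfl⟩
  have h1 := enorm_setIntegral_ball_le (q := 2) (by norm_num) hr (Fun_measurable (u : Fun n)) c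
  rw [ENNReal.ofReal_ofNat] at h1
  have h2 := hPoincare _ (Fun_measurable (u : Fun n)) (H0Log_ae_eq_zero u)
  rw [← sq_eLpNorm_two, H0Log_energy_eq, ← ENNReal.ofReal_mul hP] at h2
  have h3 : eLpNorm (u : Fun n) 2 volume ≤ ENNReal.ofReal (Real.sqrt P * ‖u‖) := by
    refine (ENNReal.pow_le_pow_left_iff two_ne_zero).1 ?_
    rwa [← ENNReal.ofReal_pow (by positivity), mul_pow, Real.sq_sqrt hP]
  have h4 : ‖φ u‖ₑ ≤ ENNReal.ofReal (Real.sqrt P * ‖u‖ * D) := by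
    rw [ENNReal.ofReal_mul (by positivity)]
    exact h1.trans (mul_le_mul' h3 le_rfl)
  rw [← ofReal_norm, ENNReal.ofReal_le_ofReal_iff (by positivity)] at h4
  linarith

/-- The compact embedding `H₀^{s+Log}(Ω) ↪ L^p(Ω)`. -/
lemma exists_compact_embedding [NeZero n] (hs : s ∈ Ioo (0 : ℝ) 1) (hn : 2 * s < (n : ℝ))
    (hΩo : IsOpen Ω) (hΩb : Bornology.IsBounded Ω) (p : ℝ≥0∞) [Fact (1 ≤ p)]
    (hp : p ≤ ENNReal.ofReal (2 * n / (n - 2 * s))) :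
    ∃ ι : H0Log n s Ω →L[ℝ] Lp ℝ p (volume.restrict Ω),
      (∀ u : H0Log n s Ω, ι u =ᵐ[volume.restrict Ω] (u : Fun n)) ∧
      Function.Injective ι ∧ IsCompactOperator ι := by
  obtain ⟨S, hS, hSob⟩ := eLpNorm_restrict_sq_le_energy hs.1 hn hΩb (Fact.out : 1 ≤ p) hp
  obtain ⟨C, hC, hfl⟩ := energy_frac_le_energy_log hs hΩb
  have hSu : ∀ u : H0Log n s Ω, eLpNorm (u : Fun n) p (volume.restrict Ω) ^ 2
      ≤ ENNReal.ofReal S * energy (fracKernel n s) (u : Fun n) := fun u =>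
    hSob _ (Fun_measurable _) (H0Log_ae_eq_zero u)
  have hCu : ∀ u : H0Log n s Ω, energy (fracKernel n s) (u : Fun n)
      ≤ ENNReal.ofReal C * ENNReal.ofReal (‖u‖ ^ 2) := fun u => by
    rw [← H0Log_energy_eq]
    exact hfl _ (Fun_measurable _) (H0Log_ae_eq_zero u)
  have hle : ∀ u : H0Log n s Ω, eLpNorm (u : Fun n) p (volume.restrict Ω)
      ≤ ENNReal.ofReal (Real.sqrt (S * C) * ‖u‖) := fun u => by
    refine (ENNReal.pow_le_pow_left_iff two_ne_zero).1 ?_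
    rw [← ENNReal.ofReal_pow (by positivity), mul_pow, Real.sq_sqrt (by positivity),
      ENNReal.ofReal_mul (by positivity), ENNReal.ofReal_mul hS, mul_assoc]
    exact (hSu u).trans (mul_le_mul' le_rfl (hCu u))
  have hmem : ∀ u : H0Log n s Ω, MemLp (u : Fun n) p (volume.restrict Ω) := fun u =>
    ⟨(Fun_measurable _).aestronglyMeasurable, (hle u).trans_lt ENNReal.ofReal_lt_top⟩
  let ι₀ : H0Log n s Ω →ₗ[ℝ] Lp ℝ p (volume.restrict Ω) :=
    { toFun := fun u => (hmem u).toLp _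
      map_add' := fun u v => by
        rw [← MemLp.toLp_add]
        exact (MemLp.toLp_eq_toLp_iff _ _).2
          (ae_restrict_of_ae (AEEqFun.coeFn_add (u : Fun n) (v : Fun n)))
      map_smul' := fun a u => by
        rw [RingHom.id_apply, ← MemLp.toLp_const_smul]
        exact (MemLp.toLp_eq_toLp_iff _ _).2
          (ae_restrict_of_ae (AEEqFun.coeFn_smul a (u : Fun n))) }
  have hnorm : ∀ u, ENNReal.ofReal (‖ι₀ u‖) = eLpNorm (u : Fun n) p (volume.restrict Ω) :=
    fun u => by
      change ENNReal.ofReal ‖(hmem u).toLp _‖ = _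
      rw [Lp.norm_toLp, ENNReal.ofReal_toReal (hmem u).2.ne]
  let ι : H0Log n s Ω →L[ℝ] Lp ℝ p (volume.restrict Ω) :=
    ι₀.mkContinuous (Real.sqrt (S * C)) fun u => by
      rw [← ENNReal.ofReal_le_ofReal_iff (by positivity), hnorm]
      exact hle u
  have hcoe : ∀ u, ι u =ᵐ[volume.restrict Ω] (u : Fun n) := fun u => (hmem u).coeFn_toLp
  have hnormι : ∀ u, ENNReal.ofReal ‖ι u‖ = eLpNorm (u : Fun n) p (volume.restrict Ω) := hnorm
  clear_value ι
  clear hnorm ι₀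
  refine ⟨ι, hcoe, fun u v huv => ?_, isCompactOperator_of_norm_sq_le ι fun ε hε => ?_⟩
  -- Agreement on `Ω` suffices, since both functions vanish outside it.
  · have h1 : ∀ᵐ x, x ∈ Ω → (u : Fun n) x = (v : Fun n) x := by
      rw [← ae_restrict_iff' hΩo.measurableSet]
      filter_upwards [hcoe u, hcoe v] with x hx hx'
      rw [← hx, ← hx', huv]
    refine Subtype.ext (AEEqFun.ext ?_)
    filter_upwards [h1, H0Log_ae_eq_zero u, H0Log_ae_eq_zero v] with x hx hxu hxv
    by_cases hxΩ : x ∈ Ω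
    · exact hx hxΩ
    · rw [hxu hxΩ, hxv hxΩ]
  have hc := cns_pos (n := n) hs
  have hω := unitBallVolume_pos (n := n)
  -- The cutoff is `δ = e^(-L)`, so `-ln δ = L`, and `L` is large enough that `S/(c_{n,s} L) ≤ ε/2`.
  -- The `+ 1` keeps `L` positive when `S = 0`.
  set L := 2 * S / (cns n s * ε) + 1 with hL
  have hLpos : 0 < L := by positivity
  have hδ : Real.exp (-L) ∈ Ioo (0 : ℝ) 1 := ⟨Real.exp_pos _, by
    rw [Real.exp_lt_one_iff]; linarith⟩
  obtain ⟨A, hA, hsplit⟩ := energy_frac_le (n := n) hs hδ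
  rw [Real.log_exp, neg_neg] at hsplit
  set B := 4 * 2 ^ ((n : ℝ) + 2 * s) / unitBallVolume n with hB
  have hBpos : 0 < B := by positivity
  -- With `δ`, hence `A`, already fixed, the ball radius is chosen with `r^(2s) = η`, making the
  -- energy part of the `L²` remainder at most `ε/2`.
  set η := ε / (2 * (S * A * B * C + 1)) with hη
  have hηpos : 0 < η := by positivity
  obtain ⟨r, hrpos, hrs⟩ : ∃ r, 0 < r ∧ r ^ (2 * s) = η := by
    have := hs.1
    refine ⟨η ^ (1 / (2 * s)), by positivity, ?_⟩
    rw [← Real.rpow_mul hηpos.le, one_div, inv_mul_cancel₀ (by positivity), Real.rpow_one]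
  obtain ⟨t, A', hA', hmeans⟩ := lintegral_sq_le_means (s := s) hs.1 hrpos hΩo hΩb
  rw [hrs, ← hB] at hmeans
  clear_value L B η
  choose φ hφ using fun c : Rn n => exists_ballIntegral (s := s) hs hΩb c hrpos
  -- The factor `t.card` compares the sum of squares with the sup norm on `Fin t.card → ℝ`.
  refine ⟨Fin t.card, inferInstance,
    ContinuousLinearMap.pi fun i => φ (t.equivFin.symm i), S * A * A' * t.card, fun w => ?_⟩
  set Φ : H0Log n s Ω →L[ℝ] (Fin t.card → ℝ) :=
    ContinuousLinearMap.pi fun i => φ (t.equivFin.symm i) with hΦ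
  set X := ‖w‖ ^ 2 with hX
  have hsum : ∑ c ∈ t, ‖∫ y in Metric.ball c r, (w : Fun n) y‖ₑ ^ 2
      ≤ ENNReal.ofReal (t.card * ‖Φ w‖ ^ 2) := by
    have hterm : ∀ c ∈ t, ‖∫ y in Metric.ball c r, (w : Fun n) y‖ₑ ^ 2
        ≤ ENNReal.ofReal (‖Φ w‖ ^ 2) := fun c hct => by
      rw [← hφ, ← ofReal_norm, ← ENNReal.ofReal_pow (norm_nonneg _)]
      refine ENNReal.ofReal_le_ofReal ?_
      have h := norm_le_pi_norm (Φ w) (t.equivFin ⟨c, hct⟩)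
      simp only [hΦ, ContinuousLinearMap.coe_pi', Equiv.symm_apply_apply] at h
      gcongr
      exact h
    refine (Finset.sum_le_card_nsmul _ _ _ hterm).trans (le_of_eq ?_)
    rw [ENNReal.ofReal_mul (by positivity), ENNReal.ofReal_natCast, nsmul_eq_mul]
  have hLX : S * (1 / (cns n s * L)) ≤ ε / 2 := by
    rw [mul_one_div, div_le_div_iff₀ (by positivity) (by norm_num), hL]
    have : ε * (cns n s * (2 * S / (cns n s * ε) + 1)) = S * 2 + ε * cns n s := by
      field_simp
    rw [this]
    have := mul_pos hε hc
    linarith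
  have hηX : S * A * B * C * η ≤ ε / 2 := by
    rw [hη, mul_div_assoc', div_le_div_iff₀ (by positivity) (by norm_num)]
    nlinarith
  have hfinal : ENNReal.ofReal (‖ι w‖ ^ 2)
      ≤ ENNReal.ofReal (S * (1 / (cns n s * L) * X
        + A * (B * η * (C * X) + A' * (t.card * ‖Φ w‖ ^ 2)))) := by
    have e1 := hmeans _ (Fun_measurable (w : Fun n)) (H0Log_memLp w) (H0Log_ae_eq_zero w)
    have e2 := hsplit _ (Fun_measurable (w : Fun n))
    rw [H0Log_energy_eq] at e2
    rw [ENNReal.ofReal_pow (norm_nonneg _), hnormι w, ENNReal.ofReal_mul hS,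
      ENNReal.ofReal_add (by positivity) (by positivity), ENNReal.ofReal_mul (by positivity),
      ENNReal.ofReal_mul hA, ENNReal.ofReal_add (by positivity) (by positivity),
      ENNReal.ofReal_mul (p := B * η) (by positivity), ENNReal.ofReal_mul hC,
      ENNReal.ofReal_mul hA']
    refine (hSu w).trans (mul_le_mul' le_rfl (e2.trans (add_le_add le_rfl
      (mul_le_mul' le_rfl (e1.trans (add_le_add ?_ ?_))))))
    · exact mul_le_mul' le_rfl (hCu w)
    · exact mul_le_mul' le_rfl hsum
  rw [ENNReal.ofReal_le_ofReal_iff (by positivity)] at hfinal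
  have hX0 : 0 ≤ X := by positivity
  have m1 := mul_le_mul_of_nonneg_right hLX hX0
  have m2 := mul_le_mul_of_nonneg_right hηX hX0
  calc _ ≤ _ := hfinal
    _ = S * (1 / (cns n s * L)) * X + S * A * B * C * η * X
        + S * A * A' * t.card * ‖Φ w‖ ^ 2 := by ring
    _ ≤ _ := by linarith

end Log

end FracLog

end

theorem proposition1p9 (n : ℕ) (s : ℝ) (hs : s ∈ Set.Ioo (0 : ℝ) 1) (hn : 2 * s < (n : ℝ))
    (Ω : Set (FracLog.Rn n)) (hΩo : IsOpen Ω) (hΩb : Bornology.IsBounded Ω) :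
    (∀ ε ∈ Set.Ioo (0 : ℝ) (1 - s),
      ∃ h : FracLog.H0 n (s + ε) Ω ≤ FracLog.H0Log n s Ω, Continuous (Submodule.inclusion h)) ∧
    (∃ h : FracLog.H0Log n s Ω ≤ FracLog.H0 n s Ω, Continuous (Submodule.inclusion h)) ∧
    (∀ (p : ℝ≥0∞) [Fact (1 ≤ p)], p ≤ ENNReal.ofReal (2 * n / (n - 2 * s)) →
      ∃ ι : FracLog.H0Log n s Ω →L[ℝ] Lp ℝ p (volume.restrict Ω),
        (∀ u : FracLog.H0Log n s Ω, ι u =ᵐ[volume.restrict Ω] (u : FracLog.Fun n)) ∧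
        Function.Injective ι ∧ IsCompactOperator ι) := by
  -- `n = 0` would force `2s < 0`.
  have : NeZero n := ⟨by
    rintro rfl
    have := hs.1
    norm_num at hn
    linarith⟩
  exact ⟨fun ε hε => FracLog.continuous_inclusion_H0_H0Log hs hΩb hε.1,
    FracLog.continuous_inclusion_H0Log_H0 hs hΩb,
    fun p _ hp => FracLog.exists_compact_embedding hs hn hΩo hΩb p hp⟩
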